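/- All rings are commutative with identity. A ring $A$ is *coherent* if every finitely generated ideal of $A$ is finitely presented, and *regular* if every finitely generated ideal of $A$ has finite projective dimension; no Noetherian hypothesis is made. For a finite sequence $\mathbf x=x_1,\dots,x_\ell$ in a ring $A$, let $H^i_{\mathbf x}(A)$ denote the cohomology of the Čech complex $\bigotimes_{i}(0\to A\to A_{x_i}\to 0)$, and let $H_i(\mathbf x^n)$ denote the homology of the Koszul complex $K(\mathbf x^n)=\bigotimes_i(0\to A\xrightarrow{x_i^n}A\to 0)$. For $m\ge n$ let $\phi^m_n:K(\mathbf x^m)\to K(\mathbf x^n)$ be the tensor product of the chain maps $K(x_i^m)\to K(x_i^n)$ which are multiplication by $x_i^{m-n}$ in degree $1$ and the identity in degree $0$. The sequence $\mathbf x$ is *weakly proregular* if for every $n$ there is an $m\ge n$ such that $\phi^m_n$ induces the zero map $H_i(\mathbf x^m)\to H_i(\mathbf x^n)$ for all $i\ge 1$. It is a *parameter sequence* if it is weakly proregular, $(\mathbf x)A\ne A$, and $H^{\ell}_{\mathbf x}(A)_p\neq 0$ for every prime ideal $p$ containing $(\mathbf x)A$. It is a *strong parameter sequence* if $x_1,\dots,x_i$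 is a parameter sequence for each $i=1,\dots,\ell$. It is a *regular sequence* if $x_i$ is a non-zero-divisor on $A/(x_1,\dots,x_{i-1})A$ for $i=1,\dots,\ell$ and $(\mathbf x)A\neq A$; the empty sequence is regarded as a regular sequence on every ring. A ring $A$ is *Cohen–Macaulay* if every strong parameter sequence on $A$ is a regular sequence, and *locally Cohen–Macaulay* if $A_p$ is Cohen–Macaulay for every prime ideal $p$ of $A$. **Theorem.** Let $R$ be a coherent regular ring of Krull dimension at most two, and let $G$ be a finite group of automorphisms of $R$ whose order is a unit in $R$. Let $R^G$ be the subring of invariants of $R$ under $G$, and assume that $R$ is a finite $R^G$-module. Then $R^G$ is a coherent, locally Cohen–Macaulay ring. -/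

import Mathlib

universe u

namespace NonNoetherianCM

/-! ### Signs -/

/-- The sign `(-1) ^ k`, where `k` is the number of elements of `s` that are smaller than `i`. -/
def posSign {ι : Type*} [LinearOrder ι] (s : Finset ι) (i : ι) : ℤ :=
  (-1) ^ (s.filter (· < i)).card

theorem posSign_insert_lt {ι : Type*} [LinearOrder ι] {s : Finset ι} {i j : ι}
    (hi : i ∉ s) (hij : i < j) : posSign (insert i s) j = - posSign s j := by
  have h : ((insert i s).filter (· < j)).card = (s.filter (· < j)).card + 1 := by
    rw [Finset.filter_insert, if_pos hij, Finset.card_insert_of_notMem (by simp [hi])]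
  rw [posSign, posSign, h, pow_succ]
  ring

theorem posSign_insert_gt {ι : Type*} [LinearOrder ι] {s : Finset ι} {i j : ι}
    (hij : j < i) : posSign (insert i s) j = posSign s j := by
  rw [posSign, posSign, Finset.filter_insert, if_neg hij.not_gt]

theorem posSign_swap {ι : Type*} [LinearOrder ι] {s : Finset ι} {i j : ι}
    (hi : i ∉ s) (hj : j ∉ s) (hij : i ≠ j) :
    posSign s i * posSign (insert i s) j = -(posSign s j * posSign (insert j s) i) := by
  rcases lt_or_gt_of_ne hij with h | h
  · rw [posSign_insert_lt hi h, posSign_insert_gt h]; ring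
  · rw [posSign_insert_gt h, posSign_insert_lt hj h]; ring

/-! ### The Koszul complex of a finite family of elements -/

section Koszul

variable {R : Type*} [CommRing R] {ι : Type*} [LinearOrder ι] [Fintype ι]

/-- The degree `p` part of the Koszul complex: the free module with basis `e_s`, for `s` a subset
of the index set with `p` elements. An element is given by its coordinates. -/
abbrev KoszulModule (R : Type*) (ι : Type*) (p : ℕ) : Type _ :=
  {s : Finset ι // s.card = p} → R

/-- Adjoining a new element to an index set. -/
def adjoin {p : ℕ} (s : {s : Finset ι // s.card = p}) (i : {i : ι // i ∉ s.1}) :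
    {s : Finset ι // s.card = p + 1} :=
  ⟨insert i.1 s.1, by rw [Finset.card_insert_of_notMem i.2, s.2]⟩

/-- The Koszul differential `e_t ↦ ∑ i ∈ t, ± x i • e_(t \ {i})`, in coordinates. This is the
differential of `K(x_1) ⊗ ⋯ ⊗ K(x_ℓ)` with `e_t` the tensor product of the generators of degree one
of the factors with index in `t` and of the generators of degree zero of the other ones. -/
def koszulD (x : ι → R) (p : ℕ) : KoszulModule R ι (p + 1) →ₗ[R] KoszulModule R ι p where
  toFun z s := ∑ i : {i : ι // i ∉ s.1}, posSign s.1 i.1 • (x i.1 * z (adjoin s i))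
  map_add' z w := by
    funext s
    simp [mul_add, Finset.sum_add_distrib]
  map_smul' r z := by
    funext s
    simp only [Pi.smul_apply, smul_eq_mul, RingHom.id_apply, Finset.mul_sum]
    refine Finset.sum_congr rfl fun i _ => ?_
    rw [mul_left_comm, mul_smul_comm]

theorem koszulD_apply (x : ι → R) (p : ℕ) (z : KoszulModule R ι (p + 1))
    (s : {s : Finset ι // s.card = p}) :
    koszulD x p z s = ∑ i : {i : ι // i ∉ s.1}, posSign s.1 i.1 • (x i.1 * z (adjoin s i)) := rfl

theorem koszulD_comp_koszulD (x : ι → R) (p : ℕ) :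
    koszulD x p ∘ₗ koszulD x (p + 1) = 0 := by
  refine LinearMap.ext fun z => funext fun s => ?_
  simp only [LinearMap.comp_apply, koszulD_apply, LinearMap.zero_apply, Pi.zero_apply,
    Finset.mul_sum, Finset.smul_sum]
  rw [Finset.sum_sigma']
  have hne : ∀ a : (i : {i : ι // i ∉ s.1}) × {j : ι // j ∉ (adjoin s i).1},
      a.2.1 ∉ s.1 ∧ a.2.1 ≠ a.1.1 := fun a => by
    have := a.2.2
    simp only [adjoin, Finset.mem_insert, not_or] at this
    exact ⟨this.2, this.1⟩
  refine Finset.sum_involution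
    (fun a _ => ⟨⟨a.2.1, (hne a).1⟩, ⟨a.1.1, by
      simp only [adjoin, Finset.mem_insert, not_or]
      exact ⟨(hne a).2.symm, a.1.2⟩⟩⟩) ?_ ?_ (fun _ _ => by simp) (fun _ _ => rfl)
  · rintro ⟨i, j⟩ -
    have h1 := posSign_swap i.2 (hne ⟨i, j⟩).1 (hne ⟨i, j⟩).2.symm
    have h2 : adjoin (adjoin s i) j = adjoin (adjoin s ⟨j.1, (hne ⟨i, j⟩).1⟩) ⟨i.1, by
        simp only [adjoin, Finset.mem_insert, not_or]
        exact ⟨(hne ⟨i, j⟩).2.symm, i.2⟩⟩ :=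
      Subtype.ext (Finset.insert_comm _ _ _)
    dsimp only
    rw [← h2]
    simp only [adjoin] at h1 ⊢
    simp only [mul_smul_comm, smul_smul]
    rw [h1, neg_smul, mul_left_comm]
    simp
  · rintro ⟨i, j⟩ - - h
    have := congrArg (fun a => a.1.1) h
    exact (hne ⟨i, j⟩).2 this

/-- The cycles of the Koszul complex. -/
def koszulCycles (x : ι → R) : (p : ℕ) → Submodule R (KoszulModule R ι p)
  | 0 => ⊤
  | p + 1 => LinearMap.ker (koszulD x p)

/-- The boundaries of the Koszul complex. -/
def koszulBoundaries (x : ι → R) (p : ℕ) : Submodule R (KoszulModule R ι p) :=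
  LinearMap.range (koszulD x p)

/-- The Koszul homology `H_p(x)`: cycles modulo boundaries. -/
abbrev KoszulHomology (x : ι → R) (p : ℕ) : Type _ :=
  koszulCycles x p ⧸ (koszulBoundaries x p).submoduleOf (koszulCycles x p)

/-- The chain map `φ^m_n : K(x^m) → K(x^n)` for `n ≤ m` in degree `p`. It is the tensor product of
the chain maps `K(x_i^m) → K(x_i^n)` that multiply by `x_i ^ (m - n)` in degree one and are the
identity in degree zero, so it multiplies `e_s` by `∏ i ∈ s, x i ^ (m - n)`. -/
def koszulPhi (x : ι → R) (m n p : ℕ) : KoszulModule R ι p →ₗ[R] KoszulModule R ι p where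
  toFun z s := (∏ i ∈ s.1, x i ^ (m - n)) * z s
  map_add' z w := by
    funext s
    simp [mul_add]
  map_smul' r z := by
    funext s
    simp [mul_left_comm]

theorem koszulPhi_comm (x : ι → R) {m n : ℕ} (hmn : n ≤ m) (p : ℕ)
    (z : KoszulModule R ι (p + 1)) :
    koszulD (fun i => x i ^ n) p (koszulPhi x m n (p + 1) z) =
      koszulPhi x m n p (koszulD (fun i => x i ^ m) p z) := by
  funext s
  simp only [koszulD_apply, koszulPhi, LinearMap.coe_mk, AddHom.coe_mk, Finset.mul_sum]
  refine Finset.sum_congr rfl fun i _ => ?_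
  have h : ∏ k ∈ (adjoin s i).1, x k ^ (m - n) =
      x i.1 ^ (m - n) * ∏ k ∈ s.1, x k ^ (m - n) := by
    rw [adjoin, Finset.prod_insert i.2]
  rw [h, mul_smul_comm]
  congr 1
  rw [← Nat.add_sub_cancel' hmn, pow_add, Nat.add_sub_cancel_left]
  ring

theorem koszulPhi_cycles (x : ι → R) {m n : ℕ} (hmn : n ≤ m) (p : ℕ) :
    ∀ z ∈ koszulCycles (fun i => x i ^ m) p,
      koszulPhi x m n p z ∈ koszulCycles (fun i => x i ^ n) p := by
  cases p with
  | zero => exact fun _ _ => Submodule.mem_top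
  | succ p =>
    intro z hz
    have hz' : koszulD (fun i => x i ^ m) p z = 0 := hz
    change koszulD (fun i => x i ^ n) p (koszulPhi x m n (p + 1) z) = 0
    rw [koszulPhi_comm x hmn, hz', map_zero]

theorem koszulPhi_boundaries (x : ι → R) {m n : ℕ} (hmn : n ≤ m) (p : ℕ) :
    (koszulBoundaries (fun i => x i ^ m) p).submoduleOf (koszulCycles (fun i => x i ^ m) p) ≤
      ((koszulBoundaries (fun i => x i ^ n) p).submoduleOf
        (koszulCycles (fun i => x i ^ n) p)).comap
          ((koszulPhi x m n p).restrict (koszulPhi_cycles x hmn p)) := by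
  rintro ⟨z, hz⟩ ⟨w, hw⟩
  exact ⟨koszulPhi x m n (p + 1) w, by
    rw [koszulPhi_comm x hmn, hw]
    rfl⟩

/-- The map `H_p(x^m) → H_p(x^n)` induced by `φ^m_n`. -/
def koszulHomologyMap (x : ι → R) {m n : ℕ} (hmn : n ≤ m) (p : ℕ) :
    KoszulHomology (fun i => x i ^ m) p →ₗ[R] KoszulHomology (fun i => x i ^ n) p :=
  Submodule.mapQ _ _ ((koszulPhi x m n p).restrict (koszulPhi_cycles x hmn p))
    (koszulPhi_boundaries x hmn p)

/-- The family `x` is weakly proregular. -/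
def IsWeaklyProregular (x : ι → R) : Prop :=
  ∀ n : ℕ, ∃ (m : ℕ) (hmn : n ≤ m), ∀ p : ℕ, 1 ≤ p → koszulHomologyMap x hmn p = 0

end Koszul

/-! ### The Čech complex of a finite family of elements -/

section Cech

variable {R : Type u} [CommRing R] {ι : Type} [LinearOrder ι]

/-- The localization `R_{x_s}` of `R` at the product of the `x i` with `i ∈ s`. -/
abbrev CechLoc (x : ι → R) (s : Finset ι) : Type u :=
  Localization.Away (∏ i ∈ s, x i)

/-- The localization map `R_{x_s} → R_{x_t}` for `s ⊆ t`. -/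
noncomputable def cechRes (x : ι → R) {s t : Finset ι} (h : s ⊆ t) :
    CechLoc x s →ₐ[R] CechLoc x t :=
  IsLocalization.Away.liftAlgHom (∏ i ∈ s, x i) (f := Algebra.ofId R (CechLoc x t))
    (isUnit_of_dvd_unit
      (map_dvd (algebraMap R (CechLoc x t)) (Finset.prod_dvd_prod_of_subset s t x h))
      (IsLocalization.Away.algebraMap_isUnit _))

theorem cechRes_cechRes (x : ι → R) {s t r : Finset ι} (h : s ⊆ t) (h' : t ⊆ r)
    (a : CechLoc x s) : cechRes x h' (cechRes x h a) = cechRes x (h.trans h') a := by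
  have : (cechRes x h').comp (cechRes x h) = cechRes x (h.trans h') :=
    IsLocalization.algHom_ext (Submonoid.powers (∏ i ∈ s, x i)) (by ext)
  exact DFunLike.congr_fun this a

/-- The degree `p` part of the Čech complex: the (finite) product of the `R_{x_s}` over the subsets
`s` of the index set with `p` elements. -/
abbrev CechModule (x : ι → R) (p : ℕ) : Type u :=
  (s : {s : Finset ι // s.card = p}) → CechLoc x s.1

/-- Removing an element from an index set. -/
def remove {p : ℕ} (t : {t : Finset ι // t.card = p + 1}) (i : {i : ι // i ∈ t.1}) :
    {s : Finset ι // s.card = p} :=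
  ⟨t.1.erase i.1, by rw [Finset.card_erase_of_mem i.2, t.2, Nat.add_sub_cancel]⟩

theorem remove_subset {p : ℕ} (t : {t : Finset ι // t.card = p + 1}) (i : {i : ι // i ∈ t.1}) :
    (remove t i).1 ⊆ t.1 :=
  Finset.erase_subset i.1 t.1

/-- The Čech differential: its component in `R_{x_t}` is the alternating sum of the localization
maps `R_{x_(t \ {i})} → R_{x_t}` over `i ∈ t`. -/
noncomputable def cechD (x : ι → R) (p : ℕ) : CechModule x p →ₗ[R] CechModule x (p + 1) where
  toFun f t := ∑ i : {i : ι // i ∈ t.1},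
    posSign t.1 i.1 • cechRes x (remove_subset t i) (f (remove t i))
  map_add' f g := by
    funext t
    simp only [Pi.add_apply, map_add, smul_add, Finset.sum_add_distrib]
  map_smul' r f := by
    funext t
    simp only [Pi.smul_apply, map_smul, RingHom.id_apply, Finset.smul_sum]
    exact Finset.sum_congr rfl fun i _ => smul_comm (posSign t.1 i.1) r _

theorem cechD_apply (x : ι → R) (p : ℕ) (f : CechModule x p)
    (t : {t : Finset ι // t.card = p + 1}) :
    cechD x p f t = ∑ i : {i : ι // i ∈ t.1},
      posSign t.1 i.1 • cechRes x (remove_subset t i) (f (remove t i)) := rfl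

theorem cechRes_congr (x : ι → R) {p : ℕ} (f : CechModule x p)
    {s s' : {s : Finset ι // s.card = p}} (h : s = s') {t : Finset ι} (hs : s.1 ⊆ t)
    (hs' : s'.1 ⊆ t) : cechRes x hs (f s) = cechRes x hs' (f s') := by
  subst h
  rfl

theorem posSign_erase_swap {t : Finset ι} {i j : ι} (hi : i ∈ t) (hj : j ∈ t) (hij : i ≠ j) :
    posSign t i * posSign (t.erase i) j = -(posSign t j * posSign (t.erase j) i) := by
  have key : ∀ {k l : ι}, k ∈ t → l ∈ t → k < l →
      posSign t k * posSign (t.erase k) l = -(posSign t l * posSign (t.erase l) k) := by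
    intro k l hk hl hkl
    have h1 : posSign t l = - posSign (t.erase k) l := by
      rw [← posSign_insert_lt (Finset.notMem_erase k t) hkl, Finset.insert_erase hk]
    have h2 : posSign t k = posSign (t.erase l) k := by
      rw [← posSign_insert_gt (s := t.erase l) hkl, Finset.insert_erase hl]
    rw [h1, h2]
    ring
  rcases lt_or_gt_of_ne hij with h | h
  · exact key hi hj h
  · rw [key hj hi h, neg_neg]

theorem cechD_comp_cechD (x : ι → R) (p : ℕ) : cechD x (p + 1) ∘ₗ cechD x p = 0 := by
  refine LinearMap.ext fun f => funext fun t => ?_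
  simp only [LinearMap.comp_apply, cechD_apply, LinearMap.zero_apply, Pi.zero_apply, map_sum,
    Finset.smul_sum]
  rw [Finset.sum_sigma']
  have hne : ∀ a : (i : {i : ι // i ∈ t.1}) × {j : ι // j ∈ (remove t i).1},
      a.2.1 ∈ t.1 ∧ a.2.1 ≠ a.1.1 := fun a => by
    have := a.2.2
    simp only [remove, Finset.mem_erase] at this
    exact ⟨this.2, this.1⟩
  refine Finset.sum_involution
    (fun a _ => ⟨⟨a.2.1, (hne a).1⟩, ⟨a.1.1, by
      simp only [remove, Finset.mem_erase]
      exact ⟨(hne a).2.symm, a.1.2⟩⟩⟩) ?_ ?_ (fun _ _ => by simp) (fun _ _ => rfl)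
  · rintro ⟨i, j⟩ -
    have h1 := posSign_erase_swap i.2 (hne ⟨i, j⟩).1 (hne ⟨i, j⟩).2.symm
    have h2 : remove (remove t i) j = remove (remove t ⟨j.1, (hne ⟨i, j⟩).1⟩) ⟨i.1, by
        simp only [remove, Finset.mem_erase]
        exact ⟨(hne ⟨i, j⟩).2.symm, i.2⟩⟩ :=
      Subtype.ext Finset.erase_right_comm
    dsimp only
    simp only [map_zsmul]
    rw [cechRes_cechRes, cechRes_cechRes,
      cechRes_congr x f h2 _ ((remove_subset _ _).trans (remove_subset _ _)), smul_smul, smul_smul]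
    simp only [remove] at h1 ⊢
    rw [h1, neg_smul, neg_add_cancel]
  · rintro ⟨i, j⟩ - - h
    have := congrArg (fun a => a.1.1) h
    exact (hne ⟨i, j⟩).2 this

/-- The cocycles of the Čech complex. -/
noncomputable def cechCocycles (x : ι → R) (p : ℕ) : Submodule R (CechModule x p) :=
  LinearMap.ker (cechD x p)

/-- The coboundaries of the Čech complex. -/
noncomputable def cechCoboundaries (x : ι → R) : (p : ℕ) → Submodule R (CechModule x p)
  | 0 => ⊥
  | p + 1 => LinearMap.range (cechD x p)

/-- The Čech cohomology `H^p_x(R)`: cocycles modulo coboundaries. -/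
abbrev CechCohomology (x : ι → R) (p : ℕ) : Type u :=
  cechCocycles x p ⧸ (cechCoboundaries x p).submoduleOf (cechCocycles x p)

end Cech

/-! ### Parameter sequences and Cohen–Macaulay rings -/

section Rings

variable {R : Type u} [CommRing R]

/-- Parameter sequences: `x` is weakly proregular, generates a proper ideal, and its top Čech
cohomology is nonzero at every prime ideal containing `x`. -/
def IsParameterSequence (x : List R) : Prop :=
  IsWeaklyProregular x.get ∧ Ideal.ofList x ≠ ⊤ ∧
    ∀ (p : Ideal R) [p.IsPrime], Ideal.ofList x ≤ p →
      Nontrivial (LocalizedModule p.primeCompl (CechCohomology x.get x.length))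

/-- Strong parameter sequences: every nonempty initial segment is a parameter sequence. -/
def IsStrongParameterSequence (x : List R) : Prop :=
  ∀ i : ℕ, 1 ≤ i → i ≤ x.length → IsParameterSequence (x.take i)

/-- Regular sequences on `R`; the empty sequence is regular on every ring (also on the zero
ring). -/
def IsRegularSequence (x : List R) : Prop :=
  x = [] ∨ RingTheory.Sequence.IsRegular R x

variable (R)

/-- A ring is Cohen–Macaulay if every strong parameter sequence is a regular sequence. -/
def IsCohenMacaulay : Prop :=
  ∀ x : List R, IsStrongParameterSequence x → IsRegularSequence x

/-- A ring is locally Cohen–Macaulay if its localizations at all primes are Cohen–Macaulay. -/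
def IsLocallyCohenMacaulay : Prop :=
  ∀ (p : Ideal R) [p.IsPrime], IsCohenMacaulay (Localization.AtPrime p)

/-- A ring is coherent if every finitely generated ideal is finitely presented. -/
def IsCoherent : Prop :=
  ∀ I : Ideal R, I.FG → Module.FinitePresentation R I

/-- A (not necessarily Noetherian) ring is regular if every finitely generated ideal has finite
projective dimension. -/
def IsRegular : Prop :=
  ∀ I : Ideal R, I.FG →
    ∃ n : ℕ, CategoryTheory.HasProjectiveDimensionLE (ModuleCat.of R I) n

end Rings

end NonNoetherianCM

/-! Write `A` for the ring of invariants. Averaging over `G` gives an `A`-linear retraction `R → A`,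
so `JR ∩ A = J` for every ideal `J` of `A`, and coherence descends by retracting syzygies. If a
prime `q` of `R` lies over `p`, then `A_p → S = R_q` also contracts extended ideals, because the
primes over `p` are conjugate (`mem_of_localRingHom_mem_map`). Divisibility and vanishing of top
Čech cohomology are ideal membership conditions, so both descend from `S` to `A_p`.

It remains to study `S`, a local ring of dimension at most two in which syzygies of finite families
have finite free resolutions. Comparing Euler characteristics at two weakly associated primes shows
that `S` is a domain. A saturated submodule of a finite free module with a finite resolution is
free, since otherwise some `S/z` of dimension at most one would have a proper finitely generated
ideal of grade two (`free_of_saturated`). Hence the syzygies of a pair `x ≠ 0, y` are free of rank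
one, and `x = dc`, `y = dc'` with `c, c'` weakly regular. If `d` is a unit, then `x, y` is weakly
regular; otherwise the dimension bound kills the top Čech cohomology of `x, y`. The same bound kills
it for three elements, so strong parameter sequences on `A_p` have length at most two and are
regular. -/

namespace NonNoetherianCM

/-! ### Krull dimension via boundary ideals -/

section Dimension

variable {S : Type*} [CommRing S]

/-- The boundary ideal of `y` relative to `J`: the preimage of the ideal generated by `y` and the
`y`-power torsion of `S ⧸ J`. -/
def boundaryIdeal (J : Ideal S) (y : S) : Ideal S where
  carrier := {t | ∃ (n : ℕ) (c : S), y ^ n * (t + c * y) ∈ J}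
  zero_mem' := ⟨0, 0, by simp⟩
  add_mem' := by
    rintro s t ⟨n, c, h⟩ ⟨m, d, h'⟩
    refine ⟨n + m, c + d, ?_⟩
    have : y ^ (n + m) * (s + t + (c + d) * y) =
      y ^ m * (y ^ n * (s + c * y)) + y ^ n * (y ^ m * (t + d * y)) := by ring
    rw [this]
    exact J.add_mem (J.mul_mem_left _ h) (J.mul_mem_left _ h')
  smul_mem' := by
    rintro r t ⟨n, c, h⟩
    refine ⟨n, r * c, ?_⟩
    have : y ^ n * (r • t + r * c * y) = r * (y ^ n * (t + c * y)) := by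
      simp only [smul_eq_mul]; ring
    rw [this]
    exact J.mul_mem_left _ h

/-- The multiplicative set generated by `y` and the complement of `P` misses `J`, so some prime over
`J` lies in `P` and omits `y`, which is in `P`. -/
theorem exists_prime_lt_of_boundaryIdeal_le {J P : Ideal S} {y : S} (hP : P.IsPrime)
    (h : boundaryIdeal J y ≤ P) : ∃ P' : Ideal S, P'.IsPrime ∧ J ≤ P' ∧ P' < P := by
  have hy : y ∈ P := h ⟨0, -1, by simp⟩
  have hdisj : Disjoint (J : Set S) (P.primeCompl ⊔ Submonoid.powers y : Submonoid S) := by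
    rw [Set.disjoint_left]
    intro t ht ht'
    obtain ⟨b, hb, _, ⟨n, rfl⟩, rfl⟩ := Submonoid.mem_sup.1 ht'
    refine hb (h ⟨n, 0, ?_⟩)
    simpa [mul_comm] using ht
  obtain ⟨P', hP', hJ, hd⟩ := Ideal.exists_le_prime_disjoint J _ hdisj
  rw [Set.disjoint_left] at hd
  refine ⟨P', hP', hJ, lt_of_le_of_ne (fun t ht => ?_) ?_⟩
  · by_contra hn
    exact hd ht (Submonoid.mem_sup_left hn)
  · rintro rfl
    exact hd hy (Submonoid.mem_sup_right (Submonoid.mem_powers y))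

/-- A prime containing the boundary taken first by `x` and then by `y` lies above two further primes
in a chain, so the dimension bound makes it maximal. Thus `w` is in the radical of this iterated
boundary ideal, and unwinding the definitions gives the relation. -/
theorem exists_dim_two_relation [IsLocalRing S] (hdim : ringKrullDim S ≤ 2) (x y : S) {w : S}
    (hw : w ∈ IsLocalRing.maximalIdeal S) :
    ∃ (n : ℕ) (a b : S), x ^ n * (y ^ n * (w ^ n + b * y) + a * x) = 0 := by
  have hrad : w ∈ (boundaryIdeal (boundaryIdeal ⊥ x) y).radical := by
    rw [Ideal.radical_eq_sInf, Ideal.mem_sInf]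
    rintro P ⟨hP2, hP⟩
    by_contra hwP
    obtain ⟨P1, hP1, hJ1, hlt1⟩ := exists_prime_lt_of_boundaryIdeal_le hP hP2
    obtain ⟨P0, hP0, -, hlt0⟩ := exists_prime_lt_of_boundaryIdeal_le hP1 hJ1
    have hlt2 : P < IsLocalRing.maximalIdeal S :=
      lt_of_le_of_ne (IsLocalRing.le_maximalIdeal hP.ne_top) (by rintro rfl; exact hwP hw)
    let s : LTSeries (PrimeSpectrum S) :=
      ⟨3, ![⟨P0, hP0⟩, ⟨P1, hP1⟩, ⟨P, hP⟩,
        ⟨_, (IsLocalRing.maximalIdeal.isMaximal S).isPrime⟩], by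
        intro i
        fin_cases i
        · exact hlt0
        · exact hlt1
        · exact hlt2⟩
    have h3 : ((3 : ℕ) : WithBot ℕ∞) ≤ 2 := (Order.LTSeries.length_le_krullDim s).trans hdim
    have : (3 : ℕ) ≤ 2 := by exact_mod_cast h3
    omega
  obtain ⟨k, n, b, m, a, h⟩ := hrad
  rw [Ideal.mem_bot] at h
  -- The three exponents are made equal to their sum by multiplying the relation by a monomial.
  refine ⟨m + n + k, a * y ^ (m + k) * w ^ (m + n), b * w ^ (m + n), ?_⟩
  calc _ = x ^ (n + k) * y ^ (m + k) * w ^ (m + n) *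
        (x ^ m * (y ^ n * (w ^ k + b * y) + a * x)) := by ring
    _ = 0 := by rw [h, mul_zero]

end Dimension

/-! ### Grade two and gluing of sections -/

section Sections

variable {B : Type*} [CommRing B]

/-- No nonzero element is killed by `T`, and every compatible family of elements of `B` indexed by
`T` is given by multiplication by an element of `B`. For the generators of an ideal, this says
that the ideal has grade at least two. -/
def HasGradeTwo (T : Set B) : Prop :=
  (∀ b : B, (∀ t ∈ T, t * b = 0) → b = 0) ∧
    ∀ g : B → B, (∀ s ∈ T, ∀ t ∈ T, s * g t = t * g s) → ∃ f : B, ∀ t ∈ T, g t = f * t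

theorem HasGradeTwo.eq {T : Set B} (h : HasGradeTwo T) {a b : B}
    (hab : ∀ t ∈ T, t * a = t * b) : a = b :=
  sub_eq_zero.1 (h.1 _ fun t ht => by rw [mul_sub, hab t ht, sub_self])

theorem HasGradeTwo.mono {T U : Set B} (h : HasGradeTwo T) (hTU : T ⊆ U) : HasGradeTwo U := by
  refine ⟨fun b hb => h.1 b fun t ht => hb t (hTU ht), fun g hg => ?_⟩
  obtain ⟨f, hf⟩ := h.2 g fun s hs t ht => hg s (hTU hs) t (hTU ht)
  refine ⟨f, fun u hu => h.eq fun t ht => ?_⟩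
  rw [hg t (hTU ht) u hu, hf t ht]
  ring

/-- For fixed `s ∈ I` the family is glued along `J` to an element `F s`; then `F` is glued along
`I`. -/
theorem HasGradeTwo.mul {I J : Ideal B} (hI : HasGradeTwo (I : Set B))
    (hJ : HasGradeTwo (J : Set B)) : HasGradeTwo ((I * J : Ideal B) : Set B) := by
  have hIJ : ∀ a b : B, (∀ s ∈ I, ∀ t ∈ J, s * t * a = s * t * b) → a = b := fun a b hab =>
    hJ.eq fun t ht => hI.eq fun s hs => by
      rw [← mul_assoc, hab s hs t ht, mul_assoc]
  refine ⟨fun b hb => hIJ b 0 fun s hs t ht => ?_, fun g hg => ?_⟩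
  · rw [mul_zero]
    exact hb _ (Ideal.mul_mem_mul hs ht)
  have hc : ∀ s ∈ I, ∀ t ∈ J, ∀ s' ∈ I, ∀ t' ∈ J,
      s * t * g (s' * t') = s' * t' * g (s * t) := fun s hs t ht s' hs' t' ht' =>
    hg _ (Ideal.mul_mem_mul hs ht) _ (Ideal.mul_mem_mul hs' ht')
  have h1 : ∀ s : B, ∃ f : B, s ∈ I → ∀ t ∈ J, g (s * t) = f * t := by
    intro s
    by_cases hs : s ∈ I
    · obtain ⟨f, hf⟩ := hJ.2 (fun t => g (s * t)) fun t ht t' ht' => by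
        refine hIJ _ _ fun σ hσ τ hτ => ?_
        linear_combination t * hc σ hσ τ hτ s hs t' ht' - t' * hc σ hσ τ hτ s hs t ht
      exact ⟨f, fun _ => hf⟩
    · exact ⟨0, fun h => absurd h hs⟩
  choose F hF using h1
  obtain ⟨f, hf⟩ := hI.2 F fun s hs s' hs' => by
    refine hJ.eq fun t ht => hIJ _ _ fun σ hσ τ hτ => ?_
    linear_combination - σ * τ * s * hF s' hs' t ht + σ * τ * s' * hF s hs t ht +
      s * hc σ hσ τ hτ s' hs' t ht - s' * hc σ hσ τ hτ s hs t ht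
  refine ⟨f, fun u hu => hIJ _ _ fun s hs t ht => ?_⟩
  rw [hg _ (Ideal.mul_mem_mul hs ht) _ hu, hF s hs t ht, hf s hs]
  ring

theorem HasGradeTwo.pow {I : Ideal B} (hI : HasGradeTwo (I : Set B)) (n : ℕ) :
    HasGradeTwo ((I ^ (n + 1) : Ideal B) : Set B) := by
  induction n with
  | zero => simpa using hI
  | succ n ih => rw [pow_succ]; exact ih.mul hI

theorem HasGradeTwo.of_le_radical {I J : Ideal B} (hI : HasGradeTwo (I : Set B)) (hfg : I.FG)
    (h : I ≤ J.radical) : HasGradeTwo (J : Set B) := by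
  obtain ⟨n, hn⟩ := Ideal.exists_pow_le_of_le_radical_of_fg h hfg
  exact (hI.pow n).mono ((Ideal.pow_le_pow_right n.le_succ).trans hn)

/-- Here `J = (e) + Ann e`. The rule `c e + w ↦ c e` glues to some `f` acting as one on `e` and as
zero on `Ann e`. In a local ring `f` or `1 - f` is a unit; the latter gives `e = 0`, and the former
leads to a contradiction. -/
theorem eq_zero_of_hasGradeTwo_sup [IsLocalRing B] {e : B}
    (he : e ∈ IsLocalRing.maximalIdeal B) {J : Ideal B} (hJe : ∀ t : B, t ∈ J ↔ ∃ c w : B,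
      w * e = 0 ∧ t = c * e + w) (hJ : HasGradeTwo (J : Set B)) : e = 0 := by
  have heJ : e ∈ J := (hJe e).2 ⟨1, 0, by simp⟩
  have hwJ : ∀ w : B, w * e = 0 → w ∈ J := fun w hw => (hJe w).2 ⟨0, w, hw, by simp⟩
  have h1 : ∀ t : B, ∃ c w : B, t ∈ J → w * e = 0 ∧ t = c * e + w := by
    intro t
    by_cases ht : t ∈ J
    · obtain ⟨c, w, h⟩ := (hJe t).1 ht
      exact ⟨c, w, fun _ => h⟩
    · exact ⟨0, 0, fun h => absurd h ht⟩
  choose c w hcw using h1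
  obtain ⟨f, hf⟩ := hJ.2 (fun t => c t * e) fun s hs t ht => by
    obtain ⟨h1, h2⟩ := hcw s hs
    obtain ⟨h3, h4⟩ := hcw t ht
    linear_combination c t * e * h2 + c t * h1 - c s * e * h4 - c s * h3
  have hfe : f * e = e := hJ.eq fun t ht => by
    have := hf t ht
    obtain ⟨h1, h2⟩ := hcw t ht
    linear_combination - e * this - e * h2 - h1
  have hfw : ∀ u : B, u * e = 0 → f * u = 0 := fun u hu => by
    refine hJ.1 _ fun t ht => ?_
    have := hf t ht
    linear_combination c t * hu - u * this
  have hunit : IsUnit f ∨ IsUnit (1 - f) := IsLocalRing.isUnit_or_isUnit_one_sub_self f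
  rcases hunit with hu | hu
  · have hreg : ∀ u : B, u * e = 0 → u = 0 := fun u h => hu.mul_right_eq_zero.1 (hfw u h)
    -- With `Ann e = 0`, division by `e` is a compatible family on `J = (e)`; gluing it inverts `e`.
    obtain ⟨f', hf'⟩ := hJ.2 c fun s hs t ht => by
      obtain ⟨h1, h2⟩ := hcw s hs
      obtain ⟨h3, h4⟩ := hcw t ht
      rw [hreg _ h1] at h2
      rw [hreg _ h3] at h4
      linear_combination c t * h2 - c s * h4
    obtain ⟨h1, h2⟩ := hcw e heJ
    have h3 : 1 - c e = 0 := hreg _ (by linear_combination h2 + hreg _ h1)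
    have h4 := hf' e heJ
    exact absurd (IsUnit.of_mul_eq_one f' (by linear_combination -h3 - h4 : e * f' = 1))
      ((IsLocalRing.mem_maximalIdeal e).1 he)
  · exact hu.mul_right_eq_zero.1 (by linear_combination - hfe)

/-- The relations express that the dimension is at most one. They put `I` in the radical of `(e^N) +
Ann(e^N)`, which then has grade two, so `e^N = 0`. Thus `I` is nil, and the zero ideal would have
grade two. -/
theorem not_hasGradeTwo [IsLocalRing B] {I : Ideal B} (hfg : I.FG)
    (hI : I ≤ IsLocalRing.maximalIdeal B)
    (hdim : ∀ e ∈ I, ∀ w ∈ I, ∃ (n : ℕ) (b : B), e ^ n * (w ^ n + b * e) = 0) :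
    ¬ HasGradeTwo (I : Set B) := by
  intro h
  have hnil : I ≤ (⊥ : Ideal B).radical := by
    intro e he
    choose n b hnb using hdim e he
    obtain ⟨T, rfl⟩ := hfg
    -- `N` bounds the exponents attached to the generators; the added one keeps `e ^ N` in the
    -- maximal ideal.
    let N := T.attach.sup (fun w => n w.1 (Ideal.subset_span w.2)) + 1
    let J : Ideal B := Ideal.span {e ^ N} ⊔ (⊥ : Ideal B).colon {e ^ N}
    have hJe : ∀ t : B, t ∈ J ↔ ∃ c w : B, w * e ^ N = 0 ∧ t = c * e ^ N + w := by
      intro t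
      simp only [J, Submodule.mem_sup, Ideal.mem_span_singleton', Submodule.mem_colon_singleton,
        smul_eq_mul, Ideal.mem_bot]
      constructor
      · rintro ⟨_, ⟨c, rfl⟩, w, hw, rfl⟩
        exact ⟨c, w, hw, rfl⟩
      · rintro ⟨c, w, hw, rfl⟩
        exact ⟨_, ⟨c, rfl⟩, w, hw, rfl⟩
    have heJ : e ∈ J.radical := ⟨N, (hJe _).2 ⟨1, 0, by simp⟩⟩
    have hJ : Ideal.span (T : Set B) ≤ J.radical := by
      refine Ideal.span_le.2 fun w hw => ?_
      have hwN : n w (Ideal.subset_span hw) ≤ N := (Finset.le_sup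
        (f := fun w : T => n w.1 (Ideal.subset_span w.2)) (Finset.mem_attach T ⟨w, hw⟩)).trans
          (Nat.le_succ _)
      have h1 : w ^ n w (Ideal.subset_span hw) + b w (Ideal.subset_span hw) * e ∈ J := by
        refine (hJe _).2 ⟨0, _, ?_, (by rw [zero_mul, zero_add])⟩
        rw [← Nat.sub_add_cancel hwN, pow_add, mul_left_comm, mul_comm (_ + _), hnb, mul_zero]
      have h2 : w ^ n w (Ideal.subset_span hw) ∈ J.radical := by
        have := J.radical.sub_mem (Ideal.le_radical h1)
          (J.radical.mul_mem_left (b w (Ideal.subset_span hw)) heJ)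
        rwa [add_sub_cancel_right] at this
      exact J.radical_isRadical.radical ▸ (⟨_, h2⟩ : w ∈ J.radical.radical)
    refine ⟨N, ?_⟩
    exact eq_zero_of_hasGradeTwo_sup (Ideal.pow_mem_of_mem _ (hI he) N (Nat.succ_pos _)) hJe
      (h.of_le_radical ⟨T, rfl⟩ hJ)
  have h0 := h.of_le_radical hfg hnil
  exact one_ne_zero (h0.1 (1 : B) fun t ht => by
    rw [show t = 0 from ht, zero_mul])

end Sections

/-! ### Finite free resolutions and Euler characteristics -/

section Resolutions

/-- `M` has a resolution of length `n` by finite free modules, ending with a finite projective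
module. -/
def HasFiniteResolution (R : Type u) [CommRing R] :
    ℕ → ∀ (M : Type u) [AddCommGroup M] [Module R M], Prop
  | 0, M, _, _ => Module.Finite R M ∧ Module.Projective R M
  | n + 1, M, _, _ => ∃ (k : ℕ) (f : (Fin k → R) →ₗ[R] M), Function.Surjective f ∧
      HasFiniteResolution R n (LinearMap.ker f)

theorem HasFiniteResolution.of_isLocalizedModule {R : Type u} [CommRing R] (W : Submonoid R)
    (S : Type u) [CommRing S] [Algebra R S] [IsLocalization W S] (n : ℕ) :
    ∀ {M M' : Type u} [AddCommGroup M] [Module R M] [AddCommGroup M'] [Module R M'] [Module S M']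
      [IsScalarTower R S M'] (g : M →ₗ[R] M') [IsLocalizedModule W g],
      HasFiniteResolution R n M → HasFiniteResolution S n M' := by
  induction n with
  | zero =>
    intro M M' _ _ _ _ _ _ g _ h
    have := h.1
    have := h.2
    exact ⟨Module.Finite.of_isLocalizedModule W (Rₚ := S) g,
      Module.projective_of_isLocalizedModule W g⟩
  | succ n ih =>
    intro M M' _ _ _ _ _ _ g _ h
    obtain ⟨k, f, hf, hK⟩ := h
    let ι : (Fin k → R) →ₗ[R] (Fin k → S) :=
      .pi fun i => Algebra.linearMap R S ∘ₗ .proj i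
    have hι : IsLocalizedModule W ι := IsLocalizedModule.pi W _
    refine ⟨k, (IsLocalizedModule.map W ι g f).extendScalarsOfIsLocalization W S,
      IsLocalizedModule.map_surjective W ι g f hf, ?_⟩
    rw [← LinearMap.localized'_ker_eq_ker_localizedMap S W ι g f]
    exact ih (Submodule.toLocalized' S W ι (LinearMap.ker f)) hK

/-- Split injectivity is tested over the residue field. A nonzero kernel vector there lifts to `v`
with a unit coordinate, and the rescaled coordinate function is `l`. -/
theorem exists_leftInverse_or_exists_mem_maximalIdeal {T : Type*} [CommRing T] [IsLocalRing T]
    {F : Type*} [AddCommGroup F] [Module T F] [Module.Finite T F] [Module.Free T F] {k : ℕ}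
    (φ : F →ₗ[T] (Fin k → T)) : (∃ l, l ∘ₗ φ = LinearMap.id) ∨
      ∃ (v : F) (l : F →ₗ[T] T), l v = 1 ∧ ∀ i, φ v i ∈ IsLocalRing.maximalIdeal T := by
  by_contra! h
  obtain ⟨h1, h2⟩ := h
  have h3 : ¬ Function.Injective (φ.lTensor (IsLocalRing.ResidueField T)) := by
    rw [← IsLocalRing.split_injective_iff_lTensor_residueField_injective]
    rintro ⟨l, hl⟩
    exact h1 l hl
  refine h3 ((injective_iff_map_eq_zero _).2 fun x hx => ?_)
  obtain ⟨v, rfl⟩ := TensorProduct.mk_surjective T F (IsLocalRing.ResidueField T)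
    IsLocalRing.residue_surjective x
  have hv : ∀ i, φ v i ∈ IsLocalRing.maximalIdeal T := fun i => by
    have := congrArg (fun z => TensorProduct.rid T _
      ((LinearMap.proj (R := T) (φ := fun _ : Fin k => T) i).lTensor
        (IsLocalRing.ResidueField T) z)) hx
    simp only [TensorProduct.mk_apply, LinearMap.lTensor_tmul, map_zero, LinearMap.proj_apply,
      TensorProduct.rid_tmul, Algebra.smul_def, mul_one] at this
    exact (IsLocalRing.residue_eq_zero_iff _).1 this
  let b := Module.Free.chooseBasis T F
  have hc : ∀ j, b.repr v j ∈ IsLocalRing.maximalIdeal T := by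
    intro j
    by_contra hj
    rw [IsLocalRing.mem_maximalIdeal, mem_nonunits_iff, not_not] at hj
    obtain ⟨u, hu⟩ := hj.exists_left_inv
    obtain ⟨i, hi⟩ := h2 v (u • b.coord j) (by simpa using hu)
    exact hi (hv i)
  rw [← b.sum_repr v, map_sum]
  refine Finset.sum_eq_zero fun j _ => ?_
  rw [map_smul, TensorProduct.mk_apply, TensorProduct.smul_tmul', Algebra.smul_def, mul_one]
  rw [show algebraMap T (IsLocalRing.ResidueField T) (b.repr v j) = 0 from
    (IsLocalRing.residue_eq_zero_iff _).2 (hc j), TensorProduct.zero_tmul]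

/-- Every finitely generated proper ideal of the local ring `T` has a nonzero annihilator. -/
def HasDepthZero (T : Type*) [CommRing T] [IsLocalRing T] : Prop :=
  ∀ E : Ideal T, E.FG → E ≤ IsLocalRing.maximalIdeal T → ∃ a : T, a ≠ 0 ∧ ∀ e ∈ E, a * e = 0

/-- A nonzero `a` killing the entries of `φ v` would give `a • v = 0`, whereas `l (a • v) = a`. -/
theorem HasDepthZero.exists_leftInverse {T : Type*} [CommRing T] [IsLocalRing T]
    (hT : HasDepthZero T) {F : Type*} [AddCommGroup F] [Module T F] [Module.Finite T F]
    [Module.Free T F] {k : ℕ} (φ : F →ₗ[T] (Fin k → T)) (hφ : Function.Injective φ) :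
    ∃ l, l ∘ₗ φ = LinearMap.id := by
  refine (exists_leftInverse_or_exists_mem_maximalIdeal φ).resolve_right ?_
  rintro ⟨v, l, hl, hv⟩
  obtain ⟨a, ha, hE⟩ := hT (Ideal.span (Set.range (φ v)))
    (Submodule.fg_span (Set.finite_range _)) (Ideal.span_le.2 (by rintro _ ⟨i, rfl⟩; exact hv i))
  have h0 : a • v = 0 := hφ (by
    rw [map_smul, map_zero]
    funext i
    exact hE _ (Ideal.subset_span ⟨i, rfl⟩))
  have := congrArg l h0
  rw [map_smul, hl, map_zero, smul_eq_mul, mul_one] at this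
  exact ha this

theorem free_of_surjective_of_leftInverse_ker {T : Type*} [CommRing T] [IsLocalRing T]
    {M : Type*} [AddCommGroup M] [Module T M] {k : ℕ} (f : (Fin k → T) →ₗ[T] M)
    (hf : Function.Surjective f) (h : ∃ l, l ∘ₗ (LinearMap.ker f).subtype = LinearMap.id) :
    Module.Free T M ∧ Nonempty ((Fin k → T) ≃ₗ[T] LinearMap.ker f × M) := by
  have hex : Function.Exact (LinearMap.ker f).subtype f := LinearMap.exact_subtype_ker_map f
  obtain ⟨e, -⟩ := ((hex.split_tfae (Submodule.injective_subtype _) hf).out 1 2).1 h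
  obtain ⟨s, hs⟩ := ((hex.split_tfae (Submodule.injective_subtype _) hf).out 1 0).1 h
  have : Module.Projective T M := Module.Projective.of_split s f hs
  have : Module.Finite T M := Module.Finite.of_surjective f hf
  exact ⟨Module.free_of_flat_of_isLocalRing, ⟨e⟩⟩

/-- At a localization of depth zero the resolution splits, so the module becomes free and its rank
is the alternating sum of the ranks in the resolution, the same for all such localizations. -/
theorem HasFiniteResolution.exists_finrank_eq {S : Type u} [CommRing S] [IsLocalRing S] (n : ℕ) :
    ∀ {M : Type u} [AddCommGroup M] [Module S M], HasFiniteResolution S n M → ∃ c : ℤ,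
      ∀ (W : Submonoid S) (T : Type u) [CommRing T] [Algebra S T] [IsLocalization W T]
        [IsLocalRing T], HasDepthZero T → ∀ (M' : Type u) [AddCommGroup M'] [Module S M']
        [Module T M'] [IsScalarTower S T M'] (g : M →ₗ[S] M') [IsLocalizedModule W g],
        Module.Finite T M' ∧ Module.Free T M' ∧ Module.finrank T M' = c := by
  induction n with
  | zero =>
    intro M _ _ h
    have := h.1
    have := h.2
    have : Module.Free S M := Module.free_of_flat_of_isLocalRing
    refine ⟨Module.finrank S M, fun W T _ _ _ _ _ M' _ _ _ _ g _ => ⟨?_, ?_, ?_⟩⟩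
    · exact Module.Finite.of_isLocalizedModule W (Rₚ := T) g
    · exact Module.free_of_isLocalizedModule W g
    · rw [Module.finrank_of_isLocalizedModule_of_free T W g]
  | succ n ih =>
    intro M _ _ h
    obtain ⟨k, f, hf, hK⟩ := h
    obtain ⟨c, hc⟩ := ih hK
    refine ⟨k - c, fun W T _ _ _ _ hT M' _ _ _ _ g _ => ?_⟩
    let ι : (Fin k → S) →ₗ[S] (Fin k → T) :=
      .pi fun i => Algebra.linearMap S T ∘ₗ .proj i
    have hι : IsLocalizedModule W ι := IsLocalizedModule.pi W _
    let f' := (IsLocalizedModule.map W ι g f).extendScalarsOfIsLocalization W T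
    have hf' : Function.Surjective f' := IsLocalizedModule.map_surjective W ι g f hf
    have hK' := hc W T hT _ (Submodule.toLocalized' T W ι (LinearMap.ker f))
    rw [LinearMap.localized'_ker_eq_ker_localizedMap T W ι g f] at hK'
    change Module.Finite T (LinearMap.ker f') ∧ Module.Free T (LinearMap.ker f') ∧
      (Module.finrank T (LinearMap.ker f') : ℤ) = c at hK'
    obtain ⟨h1, h2, h3⟩ := hK'
    have h4 : Module.Finite T M' := Module.Finite.of_surjective f' hf'
    obtain ⟨h5, ⟨e⟩⟩ := free_of_surjective_of_leftInverse_ker f' hf'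
      (hT.exists_leftInverse _ (Submodule.injective_subtype _))
    refine ⟨h4, h5, ?_⟩
    have := e.finrank_eq
    rw [Module.finrank_prod, Module.finrank_fin_fun] at this
    omega

end Resolutions

/-! ### Local rings with finite free resolutions -/

section LocalRings

theorem HasFiniteResolution.finite {R : Type u} [CommRing R] {n : ℕ} {M : Type u} [AddCommGroup M]
    [Module R M] (h : HasFiniteResolution R n M) : Module.Finite R M := by
  cases n with
  | zero => exact h.1
  | succ n =>
    obtain ⟨k, f, hf, -⟩ := h
    exact Module.Finite.of_surjective f hf

/-- The module of syzygies of every finite family of elements has a finite resolution. -/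
def HasResolvableSyzygies (S : Type u) [CommRing S] : Prop :=
  ∀ (k : ℕ) (v : Fin k → S), ∃ n : ℕ,
    HasFiniteResolution S n (LinearMap.ker (Fintype.linearCombination S v))

variable {S : Type u} [CommRing S]

/-- Minimality of `P` over `Ann a` makes some power of `E` kill the image of `a`. For the least such
power `k + 1`, a nonzero element of `E ^ k * a` is annihilated by `E`. -/
theorem hasDepthZero_atPrime_of_mem_minimalPrimes {a : S} {P : Ideal S} [P.IsPrime]
    (hP : P ∈ ((⊥ : Ideal S).colon {a}).minimalPrimes) :
    HasDepthZero (Localization.AtPrime P) := by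
  set T := Localization.AtPrime P
  set I := (⊥ : Ideal S).colon {a}
  have ha : algebraMap S T a ≠ 0 := by
    intro h
    obtain ⟨s, hs⟩ := (IsLocalization.map_eq_zero_iff P.primeCompl T a).1 h
    exact s.2 (hP.1.2 (Submodule.mem_colon_singleton.2 hs))
  intro E hfg hE
  have hrad : E ≤ ((⊥ : Ideal T).colon {algebraMap S T a}).radical := by
    intro e he
    obtain ⟨r, s, rfl⟩ := IsLocalization.exists_mk'_eq P.primeCompl e
    have hr : r ∈ P := by
      have := hE he
      rwa [IsLocalization.AtPrime.mk'_mem_maximal_iff T P] at this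
    have hnle : ¬ boundaryIdeal I r ≤ P := fun hle => by
      obtain ⟨P', hP', hI, hlt⟩ := exists_prime_lt_of_boundaryIdeal_le hP.1.1 hle
      exact hlt.not_ge (hP.2 ⟨hP', hI⟩ hlt.le)
    obtain ⟨t, ⟨n, c, htc⟩, htP⟩ := SetLike.not_le_iff_exists.1 hnle
    have htP' : t + c * r ∉ P := fun h => htP (by
      simpa using P.sub_mem h (P.mul_mem_left c hr))
    have h0 : r ^ n * (t + c * r) * a = 0 := Submodule.mem_colon_singleton.1 htc
    refine ⟨n, Submodule.mem_colon_singleton.2 ?_⟩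
    rw [Ideal.mem_bot, smul_eq_mul, ← IsLocalization.mk'_pow, mul_comm,
      ← IsLocalization.mk'_one (M := P.primeCompl) T a, ← IsLocalization.mk'_mul,
      IsLocalization.mk'_eq_zero_iff]
    exact ⟨⟨_, htP'⟩, by linear_combination h0⟩
  obtain ⟨N, hN⟩ := Ideal.exists_pow_le_of_le_radical_of_fg hrad hfg
  have hex : ∃ N : ℕ, ∀ b ∈ E ^ N, b * algebraMap S T a = 0 :=
    ⟨N, fun b hb => Submodule.mem_colon_singleton.1 (hN hb)⟩
  classical
  have hmin := fun m => Nat.find_min hex (m := m)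
  have hspec := Nat.find_spec hex
  generalize Nat.find hex = k at hmin hspec
  cases k with
  | zero => exact absurd (by simpa using hspec 1 (by simp)) ha
  | succ k =>
    have := hmin k k.lt_succ_self
    push Not at this
    obtain ⟨b, hb, hba⟩ := this
    refine ⟨_, hba, fun e he => ?_⟩
    rw [mul_right_comm]
    exact hspec _ (pow_succ E k ▸ Ideal.mul_mem_mul hb he)

theorem exists_mem_minimalPrimes_colon {a : S} (ha : a ≠ 0) :
    ∃ P : Ideal S, P.IsPrime ∧ P ∈ ((⊥ : Ideal S).colon {a}).minimalPrimes := by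
  have : ((⊥ : Ideal S).colon {a}) ≠ ⊤ := by
    intro h
    have h1 : (1 : S) ∈ ((⊥ : Ideal S).colon {a}) := h ▸ Submodule.mem_top
    have := Submodule.mem_colon_singleton.1 h1
    exact ha (by simpa using this)
  obtain ⟨m, hm, hle⟩ := Ideal.exists_le_maximal _ this
  obtain ⟨P, hP, -⟩ := Ideal.exists_minimalPrimes_le hle
  exact ⟨P, hP.1.1, hP⟩

/-- Suppose `a x = 0` with both nonzero, and take `P`, `Q` minimal over `Ann a`, `Ann x`. The ideal
`K = Ann x` is free of the same rank at `P` and `Q`. The rank is positive at `P`, where `a`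
survives, yet `x` kills `K`, so `x` would vanish in `S_Q`. -/
theorem HasResolvableSyzygies.isDomain [IsLocalRing S] (hS : HasResolvableSyzygies S) :
    IsDomain S := by
  have : NoZeroDivisors S := by
    refine ⟨fun {a x} hax => ?_⟩
    by_contra! hne
    obtain ⟨ha, hx⟩ := hne
    obtain ⟨P, hP, hPmin⟩ := exists_mem_minimalPrimes_colon ha
    obtain ⟨Q, hQ, hQmin⟩ := exists_mem_minimalPrimes_colon hx
    obtain ⟨n, hn⟩ := hS 1 ![x]
    set K := LinearMap.ker (Fintype.linearCombination S ![x])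
    have hK : ∀ v : Fin 1 → S, v ∈ K ↔ v 0 * x = 0 := fun v => by
      simp [K, Fintype.linearCombination_apply]
    obtain ⟨c, hc⟩ := hn.exists_finrank_eq
    obtain ⟨hfin1, hfree1, hrank1⟩ := hc P.primeCompl (Localization.AtPrime P)
      (hasDepthZero_atPrime_of_mem_minimalPrimes hPmin) (LocalizedModule P.primeCompl K)
      (LocalizedModule.mkLinearMap P.primeCompl K)
    obtain ⟨hfin2, hfree2, hrank2⟩ := hc Q.primeCompl (Localization.AtPrime Q)
      (hasDepthZero_atPrime_of_mem_minimalPrimes hQmin) (LocalizedModule Q.primeCompl K)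
      (LocalizedModule.mkLinearMap Q.primeCompl K)
    have hnt : Nontrivial (LocalizedModule P.primeCompl K) := by
      refine ⟨LocalizedModule.mkLinearMap P.primeCompl K ⟨fun _ => a, (hK _).2 hax⟩, 0, fun h => ?_⟩
      obtain ⟨s, hs⟩ := (IsLocalizedModule.eq_zero_iff P.primeCompl _).1 h
      refine s.2 (hPmin.1.2 (Submodule.mem_colon_singleton.2 ?_))
      exact congrFun (congrArg Subtype.val hs) 0
    let b1 := Module.Free.chooseBasis (Localization.AtPrime P) (LocalizedModule P.primeCompl K)
    let b2 := Module.Free.chooseBasis (Localization.AtPrime Q) (LocalizedModule Q.primeCompl K)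
    have hne1 := b1.index_nonempty
    have hcard1 := Fintype.card_pos (α := Module.Free.ChooseBasisIndex (Localization.AtPrime P)
      (LocalizedModule P.primeCompl K))
    rw [← Module.finrank_eq_card_chooseBasisIndex] at hcard1
    have hcard2 : 0 < Module.finrank (Localization.AtPrime Q) (LocalizedModule Q.primeCompl K) := by
      omega
    rw [Module.finrank_eq_card_chooseBasisIndex] at hcard2
    obtain ⟨j⟩ := Fintype.card_pos_iff.1 hcard2
    have hkill : x • b2 j = 0 := by
      have : (x • LinearMap.id : LocalizedModule Q.primeCompl K →ₗ[S] _) = 0 := by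
        refine IsLocalizedModule.linearMap_ext Q.primeCompl
          (LocalizedModule.mkLinearMap Q.primeCompl K) (LocalizedModule.mkLinearMap Q.primeCompl K) ?_
        ext v
        have hv : x • v = 0 := by
          ext i
          fin_cases i
          simpa [mul_comm] using (hK v.1).1 v.2
        simp only [LinearMap.comp_apply, LinearMap.smul_apply, LinearMap.id_apply,
          LinearMap.zero_apply]
        rw [← map_smul, hv, map_zero]
      exact LinearMap.congr_fun this _
    have h0 : algebraMap S (Localization.AtPrime Q) x = 0 := by
      have h1 : algebraMap S (Localization.AtPrime Q) x • b2 j = 0 := by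
        rw [algebraMap_smul, hkill]
      have := congrArg (fun v => b2.repr v j) h1
      rwa [map_smul, Finsupp.smul_apply, b2.repr_self, Finsupp.single_eq_same, smul_eq_mul, mul_one,
        map_zero, Finsupp.zero_apply] at this
    obtain ⟨s, hs⟩ := (IsLocalization.map_eq_zero_iff Q.primeCompl (Localization.AtPrime Q) x).1 h0
    exact s.2 (hQmin.1.2 (Submodule.mem_colon_singleton.2 hs))
  exact NoZeroDivisors.to_isDomain S

/-- The kernel `K` of the first map of the resolution is saturated, hence free by induction. If it
does not split off, a vector `v` of `K` with `l v = 1` has all entries in the maximal ideal. Modulo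
a nonzero entry `z`, these entries generate an ideal of grade two, contradicting `not_hasGradeTwo`.
-/
theorem HasFiniteResolution.free_of_saturated [IsLocalRing S] [IsDomain S]
    (hdim : ringKrullDim S ≤ 2) (n : ℕ) : ∀ {m : ℕ} (M : Submodule S (Fin m → S)),
      (∀ (z : S) (h : Fin m → S), z ≠ 0 → z • h ∈ M → h ∈ M) → HasFiniteResolution S n M →
        Module.Free S M := by
  induction n with
  | zero =>
    intro m M _ h
    have := h.1
    have := h.2
    exact Module.free_of_flat_of_isLocalRing
  | succ n ih =>
    intro m M hM h
    obtain ⟨k, f, hf, hres⟩ := h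
    set K := LinearMap.ker f with hKdef
    have hK : ∀ (z : S) (h : Fin k → S), z ≠ 0 → z • h ∈ K → h ∈ K := by
      intro z h hz hzh
      rw [hKdef, LinearMap.mem_ker, map_smul] at hzh
      exact (smul_eq_zero.1 hzh).resolve_left hz
    have hfree : Module.Free S K := ih K hK hres
    have hfin : Module.Finite S K := hres.finite
    rcases exists_leftInverse_or_exists_mem_maximalIdeal K.subtype with hl | ⟨v, l, hlv, hv⟩
    · exact (free_of_surjective_of_leftInverse_ker f hf hl).1
    exfalso
    have hv0 : v.1 ≠ 0 := fun h => by
      rw [show v = 0 from Subtype.ext h, map_zero] at hlv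
      exact zero_ne_one hlv
    obtain ⟨i0, hi0⟩ := Function.ne_iff.1 hv0
    obtain ⟨z, hz⟩ : ∃ z, z = v.1 i0 := ⟨_, rfl⟩
    have hz0 : z ≠ 0 := hz ▸ hi0
    have hzm : z ∈ IsLocalRing.maximalIdeal S := hz ▸ hv i0
    -- Saturation puts `u` in `K`, and `l` then recovers `s` modulo `z`.
    have hlift : ∀ (s : S) (w : Fin k → S), (∃ u : Fin k → S, s • v.1 = w + z • u) → w ∈ K →
        ∃ (w' : K) (t : S), w'.1 = w ∧ s = l w' + z * t := by
      rintro s w ⟨u, hu⟩ hw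
      have hzu : z • u ∈ K := by
        rw [← add_sub_cancel_left w (z • u), ← hu]
        exact K.sub_mem (K.smul_mem s v.2) hw
      have huK := hK z u hz0 hzu
      refine ⟨⟨w, hw⟩, l ⟨u, huK⟩, rfl, ?_⟩
      have : s • v = (⟨w, hw⟩ : K) + z • ⟨u, huK⟩ := Subtype.ext hu
      have := congrArg l this
      rwa [map_smul, map_add, map_smul, hlv, smul_eq_mul, mul_one] at this
    have hα : ∀ a : S, (∀ i, z ∣ v.1 i * a) → z ∣ a := by
      intro a ha
      choose u hu using ha
      obtain ⟨w', t, hw', ht⟩ := hlift a 0 ⟨u, by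
        funext i
        simp only [Pi.smul_apply, Pi.add_apply, Pi.zero_apply, smul_eq_mul, zero_add]
        rw [← hu, mul_comm]⟩ K.zero_mem
      rw [show w' = 0 from Subtype.ext hw', map_zero, zero_add] at ht
      exact ⟨t, ht⟩
    -- The gluing half of grade two modulo `z`. Since `f v = 0`, compatibility gives `v_i f(g) ∈ z
    -- M`, so `z` divides `f(g)` by `hα`. Saturation of `M` lets `g` be corrected by a multiple of
    -- `z` to an element of `K`, and `l` of it is `b`.
    have hβ : ∀ g : Fin k → S, (∀ i j, z ∣ v.1 i * g j - v.1 j * g i) →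
        ∃ b : S, ∀ i, z ∣ g i - b * v.1 i := by
      intro g hg
      choose u hu using hg
      have h1 : ∀ i, v.1 i • f g = z • f (u i) := by
        intro i
        have h2 : v.1 i • g = g i • v.1 + z • u i := by
          funext j
          simp only [Pi.smul_apply, Pi.add_apply, smul_eq_mul]
          linear_combination hu i j
        rw [← map_smul, h2, map_add, map_smul, map_smul, show f v.1 = 0 from v.2, smul_zero,
          zero_add]
      have h3 : ∀ j, z ∣ (f g).1 j := fun j => hα _ fun i => by
        have := congrFun (congrArg Subtype.val (h1 i)) j
        exact ⟨_, this⟩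
      choose h hh using h3
      have hfg : (f g).1 = z • h := funext hh
      have hhM : h ∈ M := hM z h hz0 (hfg ▸ (f g).2)
      obtain ⟨g', hg'⟩ := hf ⟨h, hhM⟩
      have hκ : g - z • g' ∈ K := by
        rw [hKdef, LinearMap.mem_ker, map_sub, map_smul, hg', sub_eq_zero]
        exact Subtype.ext hfg
      refine ⟨l ⟨_, hκ⟩, fun i => ?_⟩
      obtain ⟨w', t, hw', ht⟩ := hlift (g i) (v.1 i • (g - z • g')) ⟨v.1 i • g' - u i, by
        funext j
        simp only [Pi.smul_apply, Pi.add_apply, Pi.sub_apply, smul_eq_mul]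
        linear_combination -hu i j⟩ (K.smul_mem _ hκ)
      rw [show w' = v.1 i • ⟨_, hκ⟩ from Subtype.ext hw', map_smul, smul_eq_mul] at ht
      exact ⟨t, by linear_combination ht⟩
    let π := Ideal.Quotient.mk (Ideal.span {z})
    have hπ : ∀ a, π a = 0 ↔ z ∣ a := fun a => by
      rw [Ideal.Quotient.eq_zero_iff_mem, Ideal.mem_span_singleton]
    have hπs : Function.Surjective π := Ideal.Quotient.mk_surjective
    have hzle : Ideal.span {z} ≤ IsLocalRing.maximalIdeal S :=
      (Ideal.span_singleton_le_iff_mem _).2 hzm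
    have hnt : Nontrivial (S ⧸ Ideal.span {z}) := Ideal.Quotient.nontrivial_iff.2
      (ne_top_of_le_ne_top (IsLocalRing.maximalIdeal.isMaximal S).ne_top hzle)
    have hloc : IsLocalRing (S ⧸ Ideal.span {z}) := IsLocalRing.of_surjective' π hπs
    have hmax : ∀ a, π a ∈ IsLocalRing.maximalIdeal (S ⧸ Ideal.span {z}) ↔
        a ∈ IsLocalRing.maximalIdeal S := by
      intro a
      have := IsLocalRing.maximalIdeal.isMaximal S
      rw [← Ideal.mem_comap, IsLocalRing.eq_maximalIdeal
        (Ideal.comap_isMaximal_of_surjective π hπs (K := IsLocalRing.maximalIdeal _))]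
    refine not_hasGradeTwo (I := Ideal.span (Set.range fun i => π (v.1 i)))
      (Submodule.fg_span (Set.finite_range _)) (Ideal.span_le.2 ?_) ?_ ?_
    · rintro _ ⟨i, rfl⟩
      exact (hmax _).2 (hv i)
    · have hIle : Ideal.span (Set.range fun i => π (v.1 i)) ≤ IsLocalRing.maximalIdeal _ :=
        Ideal.span_le.2 (by rintro _ ⟨i, rfl⟩; exact (hmax _).2 (hv i))
      intro e _ w hw
      obtain ⟨e, rfl⟩ := hπs e
      obtain ⟨w, rfl⟩ := hπs w
      obtain ⟨n, a, b, hnab⟩ := exists_dim_two_relation hdim z e ((hmax _).1 (hIle hw))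
      refine ⟨n, π b, ?_⟩
      have h0 := (mul_eq_zero.1 hnab).resolve_left (pow_ne_zero n hz0)
      rw [← map_pow, ← map_pow, ← map_mul, ← map_add, ← map_mul, hπ]
      exact ⟨-a, by linear_combination h0⟩
    · refine HasGradeTwo.mono (T := Set.range fun i => π (v.1 i)) ⟨?_, ?_⟩ Ideal.subset_span
      · intro b hb
        obtain ⟨b, rfl⟩ := hπs b
        refine (hπ _).2 (hα b fun i => ?_)
        rw [← hπ, map_mul]
        exact hb _ ⟨i, rfl⟩
      · intro g hg
        choose G hG using fun i => hπs (g (π (v.1 i)))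
        obtain ⟨b, hb⟩ := hβ G fun i j => by
          rw [← hπ, map_sub, map_mul, map_mul, hG, hG, sub_eq_zero]
          exact hg _ ⟨i, rfl⟩ _ ⟨j, rfl⟩
        refine ⟨π b, ?_⟩
        rintro _ ⟨i, rfl⟩
        have := (hπ _).2 (hb i)
        rw [map_sub, map_mul, hG, sub_eq_zero] at this
        exact this

/-- In a local domain of dimension at most two whose syzygy modules have finite resolutions, any two
elements have a greatest common divisor after whose cancellation they form a regular sequence. -/
theorem HasResolvableSyzygies.exists_gcd [IsLocalRing S] [IsDomain S]
    (hS : HasResolvableSyzygies S) (hdim : ringKrullDim S ≤ 2) {x : S} (hx : x ≠ 0) (y : S) :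
    ∃ c c' d : S, x = d * c ∧ y = d * c' ∧ ∀ t, x ∣ y * t → c ∣ t := by
  obtain ⟨n, hn⟩ := hS 2 ![x, y]
  set K := LinearMap.ker (Fintype.linearCombination S ![x, y])
  have hK : ∀ v : Fin 2 → S, v ∈ K ↔ v 0 * x + v 1 * y = 0 := fun v => by
    simp [K, Fintype.linearCombination_apply]
  have hfree : Module.Free S K := hn.free_of_saturated hdim n K fun z h hz hzh => by
    rw [hK] at hzh ⊢
    refine (mul_eq_zero.1 (?_ : z * (h 0 * x + h 1 * y) = 0)).resolve_left hz
    simp only [Pi.smul_apply, smul_eq_mul] at hzh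
    linear_combination hzh
  have hfin : Module.Finite S K := hn.finite
  let b := Module.Free.chooseBasis S K
  have hzero : ∀ v : K, v.1 1 = 0 → v = 0 := fun v hv => by
    have h1 := (hK _).1 v.2
    rw [hv, zero_mul, add_zero] at h1
    refine Subtype.ext (funext fun i => ?_)
    fin_cases i
    · exact (mul_eq_zero.1 h1).resolve_right hx
    · exact hv
  -- `K` has rank at most one: its second coordinate is injective, and the second coordinates of two
  -- basis vectors give a linear relation between them.
  have hsub : ∀ i j : Module.Free.ChooseBasisIndex S K, i = j := by
    intro i j
    by_contra hij
    have h1 : (b j).1 1 • b i - (b i).1 1 • b j = 0 := hzero _ (by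
      simp only [Submodule.coe_sub, Submodule.coe_smul, Pi.sub_apply, Pi.smul_apply, smul_eq_mul]
      ring)
    have h2 := congrArg (fun v => b.repr v i) h1
    simp only [map_sub, map_smul, b.repr_self, Finsupp.sub_apply, Finsupp.smul_apply,
      Finsupp.single_eq_same, Finsupp.single_eq_of_ne hij, smul_eq_mul, mul_one, mul_zero, sub_zero,
      map_zero, Finsupp.zero_apply] at h2
    exact b.ne_zero j (hzero _ h2)
  have hw : (![-y, x] : Fin 2 → S) ∈ K := by
    rw [hK]
    simp
    ring
  have hne : Nonempty (Module.Free.ChooseBasisIndex S K) := by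
    by_contra hem
    rw [not_nonempty_iff] at hem
    have := b.ext_elem (x := ⟨_, hw⟩) (y := 0) fun i => hem.elim i
    exact hx (congrFun (congrArg Subtype.val this) 1)
  obtain ⟨i⟩ := hne
  have hgen : ∀ v : K, ∃ r : S, v = r • b i := fun v => by
    refine ⟨b.repr v i, ?_⟩
    conv_lhs => rw [← b.sum_repr v]
    have : Subsingleton (Module.Free.ChooseBasisIndex S K) := ⟨hsub⟩
    rw [Fintype.sum_subsingleton _ i]
  obtain ⟨d, hd⟩ := hgen ⟨_, hw⟩
  refine ⟨(b i).1 1, -(b i).1 0, d, congrFun (congrArg Subtype.val hd) 1, ?_, ?_⟩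
  · have := congrFun (congrArg Subtype.val hd) 0
    simp only [Matrix.cons_val_zero, Submodule.coe_smul, Pi.smul_apply, smul_eq_mul] at this
    linear_combination -this
  · rintro t ⟨s, hs⟩
    obtain ⟨r, hr⟩ := hgen ⟨![-s, t], (hK _).2 (by simp; linear_combination hs)⟩
    exact ⟨r, by rw [mul_comm]; exact congrFun (congrArg Subtype.val hr) 1⟩

end LocalRings

/-! ### Vanishing of top Čech cohomology -/

section TopCohomology

/-- The elementary criterion for the vanishing of the top Čech cohomology of the family `x`. -/
def TopCechVanishes {A : Type*} [CommRing A] {ι : Type*} [Fintype ι] (x : ι → A) : Prop :=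
  ∀ N : ℕ, ∃ k : ℕ, (∏ i, x i) ^ k ∈ Ideal.span (Set.range fun i => x i ^ (N + k))

/-- Expanding a fraction `a / (∏ x)^N` by `(∏ x)^k = ∑ c_i x_i^(N+k)` leaves summands in which the
`i`-th factor cancels from the denominator; each comes from a localization omitting `x_i`, so the
fraction is a coboundary. -/
theorem TopCechVanishes.subsingleton {A : Type u} [CommRing A] {ι : Type} [LinearOrder ι]
    [Fintype ι] {x : ι → A} (hx : TopCechVanishes x) {p : ℕ} (hp : Fintype.card ι = p + 1) :
    Subsingleton (CechCohomology x (p + 1)) := by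
  let t₀ : {t : Finset ι // t.card = p + 1} := ⟨Finset.univ, hp⟩
  have ht : ∀ t : {t : Finset ι // t.card = p + 1}, t = t₀ := fun t =>
    Subtype.ext (Finset.eq_univ_of_card _ (t.2.trans hp.symm))
  let L := CechLoc x t₀.1
  let V : Submodule A L := (LinearMap.range (cechD x p)).map (LinearMap.proj t₀)
  have hres : ∀ (i : {i : ι // i ∈ t₀.1}) (u : CechLoc x (remove t₀ i).1),
      cechRes x (remove_subset t₀ i) u ∈ V := by
    classical
    intro i u
    have h1 : cechD x p (Pi.single (remove t₀ i) u) t₀ =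
        posSign t₀.1 i.1 • cechRes x (remove_subset t₀ i) u := by
      rw [cechD_apply, Finset.sum_eq_single i]
      · rw [Pi.single_eq_same]
      · intro j _ hji
        have hne : remove t₀ j ≠ remove t₀ i := by
          intro h
          have h2 : i.1 ∉ (remove t₀ j).1 := by
            rw [h]
            exact Finset.notMem_erase _ _
          exact h2 (Finset.mem_erase.2 ⟨fun h => hji (Subtype.ext h.symm), i.2⟩)
        rw [Pi.single_eq_of_ne hne, map_zero]
        exact zsmul_zero _
      · simp
    have h2 : posSign t₀.1 i.1 • cechRes x (remove_subset t₀ i) u ∈ V :=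
      ⟨_, ⟨_, rfl⟩, h1⟩
    rcases neg_one_pow_eq_or ℤ (t₀.1.filter (· < i.1)).card with h | h
    · rwa [posSign, h, one_smul] at h2
    · rw [posSign, h] at h2
      exact V.neg_mem_iff.1 (neg_one_zsmul (cechRes x (remove_subset t₀ i) u) ▸ h2)
  have hV : ∀ v : L, v ∈ V := by
    intro v
    obtain ⟨⟨a, ⟨_, N, rfl⟩⟩, hv⟩ :=
      IsLocalization.surj (Submonoid.powers (∏ i ∈ t₀.1, x i)) v
    obtain ⟨k, hk⟩ := hx N
    obtain ⟨c, hc⟩ := (Ideal.mem_span_range_iff_exists_fun).1 hk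
    have hu : ∀ i : {i : ι // i ∈ t₀.1}, ∃ u : CechLoc x (remove t₀ i).1,
        u * algebraMap A _ (∏ j ∈ (remove t₀ i).1, x j) ^ (N + k) = algebraMap A _ (c i * a) := by
      intro i
      have h := IsLocalization.Away.algebraMap_isUnit (S := CechLoc x (remove t₀ i).1)
        (∏ j ∈ (remove t₀ i).1, x j)
      obtain ⟨w, hw⟩ := (h.pow (N + k)).exists_left_inv
      exact ⟨algebraMap A _ (c i * a) * w, by rw [mul_assoc, hw, mul_one]⟩
    choose u hu using hu
    have hsum : v = ∑ i, cechRes x (remove_subset t₀ i) (u i) := by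
      have hP := (IsLocalization.Away.algebraMap_isUnit (S := L) (∏ i ∈ t₀.1, x i)).pow (N + k)
      refine hP.mul_right_cancel ?_
      rw [Finset.sum_mul]
      have h1 : ∀ i, cechRes x (remove_subset t₀ i) (u i) *
          algebraMap A L (∏ i ∈ t₀.1, x i) ^ (N + k) =
            algebraMap A L (c i * x i ^ (N + k) * a) := by
        intro i
        have h2 := congrArg (cechRes x (remove_subset t₀ i)) (hu i)
        rw [map_mul, map_pow, AlgHom.commutes, AlgHom.commutes] at h2
        have h3 : algebraMap A L (∏ j ∈ t₀.1, x j) =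
            algebraMap A L (x i.1) * algebraMap A L (∏ j ∈ (remove t₀ i).1, x j) := by
          rw [← map_mul]
          exact congrArg _ (Finset.mul_prod_erase _ _ i.2).symm
        rw [h3, mul_pow, mul_left_comm, h2, ← map_pow, ← map_mul]
        congr 1
        ring
      rw [Finset.sum_congr rfl fun i _ => h1 i, ← map_sum, ← Finset.sum_mul]
      have h4 : ∑ i : {i : ι // i ∈ t₀.1}, c i * x i ^ (N + k) = ∑ i, c i * x i ^ (N + k) :=
        Finset.sum_coe_sort (Finset.univ : Finset ι) (fun i => c i * x i ^ (N + k))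
      rw [h4, hc, pow_add, ← mul_assoc]
      change v * algebraMap A L ((∏ i ∈ t₀.1, x i) ^ N) = algebraMap A L a at hv
      rw [← map_pow, hv, ← map_pow, ← map_mul, mul_comm]
    rw [hsum]
    exact V.sum_mem fun i _ => hres i (u i)
  have htop : cechCoboundaries x (p + 1) = ⊤ := by
    refine eq_top_iff.2 fun f _ => ?_
    obtain ⟨g, hg, hgf⟩ := hV (f t₀)
    have : g = f := funext fun t => by
      rw [ht t]
      exact hgf
    exact this ▸ hg
  rw [Submodule.Quotient.subsingleton_iff, htop]
  exact Submodule.submoduleOf_eq_top.2 le_top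

theorem TopCechVanishes.of_eq_zero {A : Type*} [CommRing A] {ι : Type*} [Fintype ι] {x : ι → A}
    {i : ι} (hi : x i = 0) : TopCechVanishes x := fun N => ⟨1, by
  rw [pow_one, Finset.prod_eq_zero (Finset.mem_univ i) hi]
  exact Ideal.zero_mem _⟩

theorem topCechVanishes_of_relation {S : Type*} [CommRing S] [IsLocalRing S]
    (hdim : ringKrullDim S ≤ 2) (x : Fin 3 → S) (hx : x 2 ∈ IsLocalRing.maximalIdeal S) :
    TopCechVanishes x := by
  intro N
  cases N with
  -- This case is separate because `x 2 ^ 0 = 1` is not in the maximal ideal.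
  | zero => exact ⟨0, Ideal.subset_span ⟨0, by simp⟩⟩
  | succ N =>
    obtain ⟨n, a, b, h⟩ := exists_dim_two_relation hdim (x 0 ^ (N + 1)) (x 1 ^ (N + 1))
      (Ideal.pow_mem_of_mem _ hx (N + 1) N.succ_pos)
    refine ⟨(N + 1) * n, Ideal.mem_span_range_iff_exists_fun.2
      ⟨![-a, -b * x 0 ^ ((N + 1) * n), 0], ?_⟩⟩
    simp only [Fin.sum_univ_three, Fin.prod_univ_three, Matrix.cons_val_zero, Matrix.cons_val_one,
      Matrix.cons_val_two, Matrix.tail_cons, Matrix.head_cons]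
    simp only [← pow_mul] at h
    linear_combination -h

/-- Everything depends on the common divisor `d`. If it is not a unit, the dimension relation for
powers of `c`, `c'` and for `d` trades a power of `d` for higher powers of `c` or `c'`. -/
theorem HasResolvableSyzygies.isRegular_or_topCechVanishes {S : Type u} [CommRing S]
    [IsLocalRing S] [IsDomain S] (hS : HasResolvableSyzygies S) (hdim : ringKrullDim S ≤ 2)
    (x : Fin 2 → S) (hx : x 0 ≠ 0) :
    (∀ t, x 0 ∣ x 1 * t → x 0 ∣ t) ∨ TopCechVanishes x := by
  obtain ⟨c, c', d, hc, hc', hreg⟩ := hS.exists_gcd hdim hx (x 1)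
  by_cases hd : d ∈ IsLocalRing.maximalIdeal S
  · right
    intro N
    obtain ⟨n, a, b, h⟩ := exists_dim_two_relation hdim (c ^ (N + 2)) (c' ^ (N + 2)) hd
    -- With `k = (N + 2) * (n + 2)` the product contributes `d ^ (2 * k)`. Spending `d ^ n` in the
    -- relation still leaves the required `d ^ (N + k)`, with `N * n + N + n + 4` factors to spare.
    refine ⟨(N + 2) * (n + 2), Ideal.mem_span_range_iff_exists_fun.2 ⟨![
      -a * d ^ (N * n + N + n + 4) * c ^ 2 * c' ^ (2 * (N + 2)),
      -b * d ^ (N * n + N + n + 4) * c ^ ((N + 2) * (n + 2)) * c' ^ 2], ?_⟩⟩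
    simp only [Fin.sum_univ_two, Fin.prod_univ_two, Matrix.cons_val_zero, Matrix.cons_val_one,
      hc, hc']
    linear_combination -(c * c') ^ (2 * (N + 2)) *
      d ^ (N + (N + 2) * (n + 2) + (N * n + N + n + 4)) * h
  · left
    rw [IsLocalRing.mem_maximalIdeal, mem_nonunits_iff, not_not] at hd
    intro t ht
    rw [hc]
    exact (hd.mul_left_dvd).2 (hreg t ht)

end TopCohomology

/-! ### Descent of the Cohen–Macaulay property -/

section CohenMacaulayDescent

theorem IsParameterSequence.not_topCechVanishes {A : Type u} [CommRing A] [IsLocalRing A] {a : A}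
    {l : List A} (h : IsParameterSequence (a :: l)) : ¬ TopCechVanishes (a :: l).get := by
  intro hv
  obtain ⟨-, hne, hloc⟩ := h
  have hsub := hv.subsingleton (p := l.length) (by simp)
  have : (IsLocalRing.maximalIdeal A).IsPrime := (IsLocalRing.maximalIdeal.isMaximal A).isPrime
  have hnt := hloc (IsLocalRing.maximalIdeal A) (IsLocalRing.le_maximalIdeal hne)
  change Subsingleton (CechCohomology (a :: l).get (a :: l).length) at hsub
  refine not_subsingleton (LocalizedModule (IsLocalRing.maximalIdeal A).primeCompl
    (CechCohomology (a :: l).get (a :: l).length)) (subsingleton_of_forall_eq 0 fun z => ?_)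
  induction z using LocalizedModule.induction_on with
  | h m s => rw [Subsingleton.elim m 0, LocalizedModule.zero_mk]

/-- Contraction makes `A` a domain and transports divisibility and vanishing from `S` to `A`. A
parameter sequence has nonvanishing top cohomology, which excludes a zero first element, the second
alternative for pairs, and every length above two. -/
theorem isCohenMacaulay_of_contracted {A S : Type u} [CommRing A] [IsLocalRing A] [CommRing S]
    [IsLocalRing S] (φ : A →+* S) (hφ : ∀ (J : Ideal A) (a : A), φ a ∈ J.map φ → a ∈ J)
    (hS : HasResolvableSyzygies S) (hdim : ringKrullDim S ≤ 2) : IsCohenMacaulay A := by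
  have hdom : IsDomain S := hS.isDomain
  have hinj : ∀ a : A, φ a = 0 → a = 0 := fun a ha => hφ ⊥ a (by rw [ha]; exact Ideal.zero_mem _)
  have hdvd : ∀ a b : A, φ a ∣ φ b → a ∣ b := fun a b h => by
    rw [← Ideal.mem_span_singleton]
    refine hφ _ _ ?_
    rwa [Ideal.map_span, Set.image_singleton, Ideal.mem_span_singleton]
  have hmax : ∀ a ∈ IsLocalRing.maximalIdeal A, φ a ∈ IsLocalRing.maximalIdeal S := by
    intro a ha hu
    refine ha (isUnit_of_dvd_one (hdvd a 1 ?_))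
    exact hu.dvd
  have hvan : ∀ (n : ℕ) (x : Fin n → A), TopCechVanishes (fun i => φ (x i)) → TopCechVanishes x := by
    intro n x h N
    obtain ⟨k, hk⟩ := h N
    refine ⟨k, hφ _ _ ?_⟩
    rw [Ideal.map_span, ← Set.range_comp]
    have h1 : (φ ∘ fun i => x i ^ (N + k)) = fun i => φ (x i) ^ (N + k) :=
      funext fun i => map_pow φ _ _
    rw [h1, map_pow, map_prod]
    exact hk
  have hreg : ∀ a : A, a ≠ 0 → IsSMulRegular A a := by
    intro a ha
    rw [isSMulRegular_iff_right_eq_zero_of_smul]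
    intro b hb
    have : φ a * φ b = 0 := by rw [← map_mul, ← smul_eq_mul, hb, map_zero]
    exact hinj b ((mul_eq_zero.1 this).resolve_left fun h => ha (hinj a h))
  have hne0 : ∀ a : A, IsParameterSequence [a] → a ≠ 0 := fun a h h0 =>
    h.not_topCechVanishes (TopCechVanishes.of_eq_zero (i := (0 : Fin 1)) h0)
  intro x hx
  match x, hx with
  | [], _ => exact Or.inl rfl
  | [a], hx =>
    have h1 : IsParameterSequence [a] := hx 1 le_rfl le_rfl
    refine Or.inr ⟨?_, ?_⟩
    · rw [RingTheory.Sequence.isWeaklyRegular_singleton_iff]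
      exact hreg a (hne0 a h1)
    · rw [smul_eq_mul, Ideal.mul_top]
      exact h1.2.1.symm
  | [a, b], hx =>
    have h1 : IsParameterSequence [a] := hx 1 le_rfl (by simp)
    have h2 : IsParameterSequence [a, b] := hx 2 (by simp) le_rfl
    have ha := hne0 a h1
    refine Or.inr ⟨?_, ?_⟩
    · rw [RingTheory.Sequence.isWeaklyRegular_cons_iff,
        RingTheory.Sequence.isWeaklyRegular_singleton_iff]
      refine ⟨hreg a ha, ?_⟩
      rcases hS.isRegular_or_topCechVanishes hdim ![φ a, φ b] (fun h => ha (hinj a h)) with h | h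
      · refine (isSMulRegular_quotient_iff_mem_of_smul_mem _ _).2 fun t ht => ?_
        obtain ⟨u, -, hu⟩ := (Submodule.mem_smul_pointwise_iff_exists _ _ _).1 ht
        obtain ⟨w, hw⟩ := hdvd a t (h (φ t) ⟨φ u, by
          simpa using (congrArg φ hu).symm⟩)
        exact (Submodule.mem_smul_pointwise_iff_exists _ _ _).2 ⟨w, Submodule.mem_top, hw.symm⟩
      · refine absurd (hvan 2 [a, b].get ?_) h2.not_topCechVanishes
        convert h using 1
        funext i
        fin_cases i <;> rfl
    · rw [smul_eq_mul, Ideal.mul_top]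
      exact h2.2.1.symm
  | a :: b :: c :: l, hx =>
    have h3 : IsParameterSequence [a, b, c] := hx 3 (by simp) (by simp)
    have hc : c ∈ IsLocalRing.maximalIdeal A := IsLocalRing.le_maximalIdeal h3.2.1
      (Ideal.subset_span (by simp))
    exact absurd (hvan 3 [a, b, c].get (topCechVanishes_of_relation hdim _ (hmax c hc)))
      h3.not_topCechVanishes

end CohenMacaulayDescent

/-! ### Resolutions over coherent regular rings -/

section Coherent

open CategoryTheory

variable {R : Type u} [CommRing R]

/-- The first coordinate maps `N` onto a finitely generated ideal, which is finitely presented; the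
kernel is then finitely generated and embeds in a free module of smaller rank. -/
theorem IsCoherent.finitePresentation_of_injective (hR : IsCoherent R) (k : ℕ) :
    ∀ {N : Type u} [AddCommGroup N] [Module R N] [Module.Finite R N] (i : N →ₗ[R] (Fin k → R)),
      Function.Injective i → Module.FinitePresentation R N := by
  induction k with
  | zero =>
    intro N _ _ _ i hi
    have := hi.subsingleton
    infer_instance
  | succ k ih =>
    intro N _ _ _ i hi
    let q : N →ₗ[R] R := LinearMap.proj 0 ∘ₗ i
    have h1 : Module.FinitePresentation R (LinearMap.range q) :=
      hR _ (Module.Finite.iff_fg.1 inferInstance)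
    have h2 : Module.Finite R (LinearMap.ker q.rangeRestrict) :=
      Module.Finite.iff_fg.2 (Module.FinitePresentation.fg_ker _ q.surjective_rangeRestrict)
    have h3 : Module.FinitePresentation R (LinearMap.ker q.rangeRestrict) := by
      refine ih (LinearMap.funLeft R R Fin.succ ∘ₗ i ∘ₗ (LinearMap.ker q.rangeRestrict).subtype) ?_
      refine (injective_iff_map_eq_zero _).2 fun v hv => Subtype.ext (hi ?_)
      rw [Submodule.coe_zero, map_zero]
      funext j
      refine Fin.cases ?_ (fun j => congrFun hv j) j
      exact congrArg Subtype.val v.2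
    exact Module.finitePresentation_of_ker q.rangeRestrict q.surjective_rangeRestrict

theorem hasProjectiveDimensionLE_ker {M : Type u} [AddCommGroup M] [Module R M] {k : ℕ}
    (f : (Fin k → R) →ₗ[R] M) (hf : Function.Surjective f) (n : ℕ)
    (h : HasProjectiveDimensionLE (ModuleCat.of R M) (n + 1)) :
    HasProjectiveDimensionLE (ModuleCat.of R (LinearMap.ker f)) n := by
  have hproj : Projective (ModuleCat.of R (Fin k → R)) :=
    (IsProjective.iff_projective _).1 inferInstance
  exact (LinearMap.shortExact_shortComplexKer hf).hasProjectiveDimensionLT_X₁ (n + 1)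
    (inferInstanceAs (HasProjectiveDimensionLT (ModuleCat.of R (Fin k → R)) (n + 1))) h

theorem IsCoherent.hasFiniteResolution (hR : IsCoherent R) (n : ℕ) :
    ∀ (M : Type u) [AddCommGroup M] [Module R M] [Module.FinitePresentation R M],
      HasProjectiveDimensionLE (ModuleCat.of R M) n → HasFiniteResolution R n M := by
  induction n with
  | zero =>
    intro M _ _ _ h
    refine ⟨inferInstance, ?_⟩
    rw [IsProjective.iff_projective]
    exact projective_iff_hasProjectiveDimensionLT_one.2 h
  | succ n ih =>
    intro M _ _ _ h
    obtain ⟨k, f, hf⟩ := Module.Finite.exists_fin' R M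
    have h1 : Module.Finite R (LinearMap.ker f) :=
      Module.Finite.iff_fg.2 (Module.FinitePresentation.fg_ker f hf)
    have h2 : Module.FinitePresentation R (LinearMap.ker f) :=
      hR.finitePresentation_of_injective k _ (Submodule.injective_subtype _)
    exact ⟨k, f, hf, ih _ (hasProjectiveDimensionLE_ker f hf n h)⟩

theorem IsRegular.hasResolvableSyzygies (hreg : IsRegular R) (hR : IsCoherent R) :
    HasResolvableSyzygies R := by
  intro k v
  let f := Fintype.linearCombination R v
  have hfg : (LinearMap.range f).FG := Module.Finite.iff_fg.1 inferInstance
  obtain ⟨n, hn⟩ := hreg _ hfg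
  have h0 : Module.FinitePresentation R (LinearMap.range f) := hR _ hfg
  rw [← LinearMap.ker_rangeRestrict]
  have h1 : Module.Finite R (LinearMap.ker f.rangeRestrict) :=
    Module.Finite.iff_fg.2 (Module.FinitePresentation.fg_ker _ f.surjective_rangeRestrict)
  have h2 : Module.FinitePresentation R (LinearMap.ker f.rangeRestrict) :=
    hR.finitePresentation_of_injective k _ (Submodule.injective_subtype _)
  have h3 : HasProjectiveDimensionLE (ModuleCat.of R (LinearMap.range f)) (n + 1) :=
    hasProjectiveDimensionLT_of_ge _ (n + 1) (n + 2) (by omega)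
  exact ⟨n, hR.hasFiniteResolution n _
    (hasProjectiveDimensionLE_ker _ f.surjective_rangeRestrict n h3)⟩

/-- Clearing a common denominator does not change the syzygies, and taking kernels commutes with
localization. -/
theorem HasResolvableSyzygies.localization (hR : HasResolvableSyzygies R) (W : Submonoid R)
    (S : Type u) [CommRing S] [Algebra R S] [IsLocalization W S] : HasResolvableSyzygies S := by
  intro k v
  obtain ⟨b, hb⟩ := IsLocalization.exist_integer_multiples_of_finite W v
  choose v₀ hv₀ using hb
  obtain ⟨n, hn⟩ := hR k v₀
  let ι : (Fin k → R) →ₗ[R] (Fin k → S) := .pi fun i => Algebra.linearMap R S ∘ₗ .proj i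
  have hι : IsLocalizedModule W ι := IsLocalizedModule.pi W _
  refine ⟨n, ?_⟩
  have hker : (LinearMap.ker (Fintype.linearCombination R v₀)).localized' S W ι =
      LinearMap.ker (Fintype.linearCombination S v) := by
    have hmap : IsLocalizedModule.map W ι (Algebra.linearMap R S)
        (Fintype.linearCombination R v₀) =
          (Fintype.linearCombination S fun i => algebraMap R S (v₀ i)).restrictScalars R := by
      refine IsLocalizedModule.linearMap_ext W ι (Algebra.linearMap R S) ?_
      ext i
      simp [Fintype.linearCombination_apply, ι, IsLocalizedModule.map_apply]
    ext c
    rw [LinearMap.localized'_ker_eq_ker_localizedMap S W ι (Algebra.linearMap R S), hmap]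
    have h1 : Fintype.linearCombination S (fun i => algebraMap R S (v₀ i)) c =
        algebraMap R S b * Fintype.linearCombination S v c := by
      simp only [Fintype.linearCombination_apply, Finset.mul_sum, smul_eq_mul]
      refine Finset.sum_congr rfl fun i _ => ?_
      rw [hv₀, Algebra.smul_def]
      ring
    change Fintype.linearCombination S (fun i => algebraMap R S (v₀ i)) c = 0 ↔
      Fintype.linearCombination S v c = 0
    rw [h1, (IsLocalization.map_units S b).mul_right_eq_zero]
  rw [← hker]
  exact hn.of_isLocalizedModule W S n (Submodule.toLocalized' S W ι _)

end Coherent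

/-! ### Invariants, retractions and localization -/

section Invariants

variable {R : Type u} [CommRing R] {G : Type*} [Group G] [MulSemiringAction G R]

/-- The Reynolds operator. -/
theorem exists_reynolds [Finite G] (hG : IsUnit (Nat.card G : R)) :
    ∃ ρ : R →ₗ[FixedPoints.subring R G] FixedPoints.subring R G,
      ∀ a : FixedPoints.subring R G, ρ (a : R) = a := by
  cases nonempty_fintype G
  obtain ⟨u, hu⟩ := hG.exists_left_inv
  rw [Nat.card_eq_fintype_card] at hu
  have hfix : ∀ r : R, u * ∑ g : G, g • r ∈ FixedPoints.subring R G := by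
    intro r h
    -- The inverse of an integer is fixed by every automorphism.
    have hu' : h • u = u := by
      have h1 : h • u * (Fintype.card G : R) = 1 := by
        have h2 : h • ((Fintype.card G : R)) = (Fintype.card G : R) :=
          map_natCast (MulSemiringAction.toRingHom G R h) _
        rw [← h2, ← smul_mul', hu, smul_one]
      calc h • u = h • u * (u * (Fintype.card G : R)) := by rw [hu, mul_one]
        _ = u * (h • u * (Fintype.card G : R)) := by ring
        _ = u := by rw [h1, mul_one]
    rw [smul_mul', hu', Finset.smul_sum]
    congr 1
    exact Fintype.sum_equiv (Equiv.mulLeft h) _ _ fun g => by simp [mul_smul]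
  refine ⟨⟨⟨fun r => ⟨_, hfix r⟩, fun r s => Subtype.ext ?_⟩, fun a r => Subtype.ext ?_⟩,
    fun a => Subtype.ext ?_⟩
  · simp [Finset.sum_add_distrib, mul_add]
  · have h1 : ∀ g : G, g • (a • r) = a • (g • r) := fun g => smul_comm g a r
    simp only [h1, ← Finset.smul_sum, mul_smul_comm]
    rfl
  · have h1 : ∀ g : G, g • (a : R) = a := a.2
    change u * ∑ g : G, g • (a : R) = a
    simp only [h1, Finset.sum_const, Finset.card_univ, nsmul_eq_mul]
    rw [← mul_assoc, hu, one_mul]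

/-- By linearity `ρ` maps `JB` into `J`, and it fixes `a`. -/
theorem mem_of_algebraMap_mem_map_of_retraction {A B : Type*} [CommRing A] [CommRing B]
    [Algebra A B] (ρ : B →ₗ[A] A) (hρ : ∀ a, ρ (algebraMap A B a) = a) {J : Ideal A} {a : A}
    (ha : algebraMap A B a ∈ J.map (algebraMap A B)) : a ∈ J := by
  have h : ∀ b ∈ (J • ⊤ : Submodule A B), ρ b ∈ J := fun b hb => by
    refine Submodule.smul_induction_on hb (fun r hr n _ => ?_) fun x y hx hy => ?_
    · rw [map_smul]
      exact J.mul_mem_right _ hr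
    · rw [map_add]
      exact J.add_mem hx hy
  rw [← hρ a]
  refine h _ ?_
  rw [Ideal.smul_top_eq_map]
  exact ha

/-- Applied coordinatewise, `ρ` maps the syzygies over `B` onto those over `A`; the former are
finitely generated over `B`, hence over `A`. -/
theorem IsCoherent.of_retraction {A B : Type u} [CommRing A] [CommRing B] [Algebra A B]
    [Module.Finite A B] (ρ : B →ₗ[A] A) (hρ : ∀ a, ρ (algebraMap A B a) = a)
    (hB : IsCoherent B) : IsCoherent A := by
  intro I hI
  obtain ⟨k, v, hv⟩ := Submodule.fg_iff_exists_fin_generating_family.1 hI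
  let f := Fintype.linearCombination A v
  let w : Fin k → B := fun i => algebraMap A B (v i)
  let f' := Fintype.linearCombination B w
  have hrange : LinearMap.range f = I := by
    rw [← hv, Fintype.range_linearCombination]
  have h0 : Module.FinitePresentation B (LinearMap.range f') :=
    hB _ (Module.Finite.iff_fg.1 inferInstance)
  have h1 : Module.Finite B (LinearMap.ker f') := by
    rw [← LinearMap.ker_rangeRestrict]
    exact Module.Finite.iff_fg.2
      (Module.FinitePresentation.fg_ker _ f'.surjective_rangeRestrict)
  have h2 : Module.Finite A (LinearMap.ker f') := Module.Finite.trans B _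
  let P : (Fin k → B) →ₗ[A] (Fin k → A) := ρ.compLeft (Fin k)
  have h3 : LinearMap.ker f = ((LinearMap.ker f').restrictScalars A).map P := by
    ext c
    constructor
    · intro hc
      refine ⟨fun i => algebraMap A B (c i), ?_, funext fun i => hρ _⟩
      have hc' : ∑ i, c i • v i = 0 := hc
      change ∑ i, algebraMap A B (c i) • algebraMap A B (v i) = 0
      simpa using congrArg (algebraMap A B) hc'
    · rintro ⟨b, hb, rfl⟩
      have hb' : ∑ i, b i • algebraMap A B (v i) = 0 := hb
      change ∑ i, ρ (b i) • v i = 0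
      have := congrArg ρ hb'
      rw [map_sum, map_zero] at this
      rw [← this]
      refine Finset.sum_congr rfl fun i _ => ?_
      rw [smul_eq_mul, smul_eq_mul, mul_comm (b i), ← Algebra.smul_def, map_smul, smul_eq_mul, mul_comm]
  have h4 : (LinearMap.ker f).FG := by
    rw [h3]
    exact Submodule.FG.map _ (Module.Finite.iff_fg.1 h2)
  rw [← hrange]
  refine Module.finitePresentation_of_surjective f.rangeRestrict f.surjective_rangeRestrict ?_
  rwa [LinearMap.ker_rangeRestrict]

/-- After clearing denominators, the colon ideal `I = (J₀R : a)` is stable under `G` and not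
contained in `q`. All primes over `p` are conjugate to `q`, so none contains `I`. By lying over, `I`
meets `A` outside `p`, and the retraction finishes the argument. -/
theorem mem_of_localRingHom_mem_map {A : Type*} [CommRing A] [Algebra A R] [Finite G]
    [SMulCommClass G A R] [Algebra.IsInvariant A R G] (ρ : R →ₗ[A] A)
    (hρ : ∀ a, ρ (algebraMap A R a) = a) (p : Ideal A) [p.IsPrime] (q : Ideal R) [q.IsPrime]
    (hpq : p = q.comap (algebraMap A R)) (J : Ideal (Localization.AtPrime p))
    (a : Localization.AtPrime p) (ha : Localization.localRingHom p q (algebraMap A R) hpq a ∈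
      J.map (Localization.localRingHom p q (algebraMap A R) hpq)) : a ∈ J := by
  have hint : Algebra.IsIntegral A R := Algebra.IsInvariant.isIntegral A R G
  set φ := Localization.localRingHom p q (algebraMap A R) hpq
  obtain ⟨J₀, hJ₀⟩ : ∃ J₀, J = Ideal.map (algebraMap A (Localization.AtPrime p)) J₀ :=
    ⟨_, (IsLocalization.map_under p.primeCompl _ J).symm⟩
  obtain ⟨a, s, rfl⟩ := IsLocalization.exists_mk'_eq p.primeCompl a
  have hmk : ∀ K : Ideal (Localization.AtPrime p), IsLocalization.mk' _ a s ∈ K ↔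
      algebraMap A (Localization.AtPrime p) a ∈ K := fun K =>
    IsLocalization.mk'_mem_iff
  rw [hmk]
  have hφ : ∀ c, φ (algebraMap A _ c) = algebraMap R (Localization.AtPrime q) (algebraMap A R c) :=
    fun c => Localization.localRingHom_to_map _ _ _ _ _
  have hφ' : φ.comp (algebraMap A _) = (algebraMap R (Localization.AtPrime q)).comp (algebraMap A R) :=
    RingHom.ext hφ
  have h1 : algebraMap R (Localization.AtPrime q) (algebraMap A R a) ∈
      (J₀.map (algebraMap A R)).map (algebraMap R (Localization.AtPrime q)) := by
    rw [Ideal.map_map, ← hφ', ← Ideal.map_map, ← hJ₀, ← hφ]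
    rw [← Ideal.mem_comap] at ha ⊢
    exact (hmk _).1 ha
  rw [IsLocalization.algebraMap_mem_map_algebraMap_iff q.primeCompl] at h1
  obtain ⟨t, ht, hta⟩ := h1
  have hstable : ∀ (g : G), ∀ r ∈ J₀.map (algebraMap A R), g • r ∈ J₀.map (algebraMap A R) := by
    intro g r hr
    have h2 := Ideal.mem_map_of_mem (MulSemiringAction.toRingHom G R g) hr
    rw [Ideal.map_map] at h2
    have h3 : (MulSemiringAction.toRingHom G R g).comp (algebraMap A R) = algebraMap A R :=
      RingHom.ext fun c => smul_algebraMap g c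
    rwa [h3] at h2
  let I : Ideal R := (J₀.map (algebraMap A R)).colon {algebraMap A R a}
  have hI : ∀ r, r ∈ I ↔ r * algebraMap A R a ∈ J₀.map (algebraMap A R) := fun r =>
    Submodule.mem_colon_singleton
  have hnle : ¬ I.comap (algebraMap A R) ≤ p := by
    intro hle
    obtain ⟨Q, hIQ, hQ, hQp⟩ := Ideal.exists_ideal_over_prime_of_isIntegral p I hle
    obtain ⟨g, hg⟩ := Algebra.IsInvariant.exists_smul_of_under_eq A R G Q q (hQp.trans hpq)
    refine ht ?_
    rw [hg, SetLike.mem_coe, Ideal.mem_pointwise_smul_iff_inv_smul_mem]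
    refine hIQ ((hI _).2 ?_)
    have h2 := hstable g⁻¹ _ hta
    have h3 : g⁻¹ • algebraMap A R a = algebraMap A R a := smul_algebraMap g⁻¹ a
    rwa [smul_mul', h3] at h2
  obtain ⟨c, hcI, hcp⟩ := SetLike.not_le_iff_exists.1 hnle
  have hca : c * a ∈ J₀ := mem_of_algebraMap_mem_map_of_retraction ρ hρ (by
    rw [map_mul]
    exact (hI _).1 hcI)
  rw [hJ₀, IsLocalization.algebraMap_mem_map_algebraMap_iff p.primeCompl]
  exact ⟨c, hcp, hca⟩

end Invariants

end NonNoetherianCM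

theorem corollary4p15 (R : Type u) [CommRing R]
    (hcoh : NonNoetherianCM.IsCoherent R) (hreg : NonNoetherianCM.IsRegular R)
    (hdim : ringKrullDim R ≤ 2)
    (G : Subgroup (RingAut R)) [Finite G] (hG : IsUnit (Nat.card G : R))
    (hfin : Module.Finite (FixedPoints.subring R G) R) :
    NonNoetherianCM.IsCoherent (FixedPoints.subring R G) ∧
      NonNoetherianCM.IsLocallyCohenMacaulay (FixedPoints.subring R G) := by
  obtain ⟨ρ, hρ⟩ := NonNoetherianCM.exists_reynolds hG
  refine ⟨NonNoetherianCM.IsCoherent.of_retraction ρ hρ hcoh, fun p _ => ?_⟩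
  have hinv : Algebra.IsInvariant (FixedPoints.subring R G) R G := ⟨fun b hb => ⟨⟨b, hb⟩, rfl⟩⟩
  have hint : Algebra.IsIntegral (FixedPoints.subring R G) R := hinv.isIntegral _ R G
  obtain ⟨q, -, hq, hqp⟩ := Ideal.exists_ideal_over_prime_of_isIntegral p (⊥ : Ideal R) (by
    intro a ha
    rw [show a = 0 from Subtype.ext ha]
    exact p.zero_mem)
  refine NonNoetherianCM.isCohenMacaulay_of_contracted
    (Localization.localRingHom p q (algebraMap _ R) hqp.symm)
    (NonNoetherianCM.mem_of_localRingHom_mem_map (G := G) ρ hρ p q hqp.symm)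
    ((hreg.hasResolvableSyzygies hcoh).localization q.primeCompl _) ?_
  rw [IsLocalization.AtPrime.ringKrullDim_eq_height q]
  exact (Ideal.height_le_ringKrullDim_of_ne_top hq.ne_top).trans hdim
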